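/- Conventions. For a real random variable $X$ put $\rho_+(X)=\sup\{s\in\mathbb R: E|X|^s<\infty\}$ and $\rho_-(X)=\inf\{s\in\mathbb R: E|X|^s<\infty\}$ (with $0^s=\infty$ for $s<0$). We say that $|X|$ has moments of Gamma type on a strip $a<\Re s<b$ if there $$E|X|^s = C D^s\,\frac{\prod_{j=1}^J\Gamma(a_js+b_j)}{\prod_{k=1}^K\Gamma(a'_ks+b'_k)}$$ with real constants $C$, $D>0$, $a_j,a'_k\ne0$, $b_j,b'_k$, the integral converging absolutely and no Gamma factor having a pole in the strip; to such an expression belong the parameters $\gamma=\sum|a_j|-\sum|a'_k|$, $\gamma'=\sum a_j-\sum a'_k$, $\delta=\sum b_j-\sum b'_k-\frac{J-K}2$, $\kappa=\sum a_j\log|a_j|-\sum a'_k\log|a'_k|+\log D$, $C_1=|C|(2\pi)^{(J-K)/2}\prod|a_j|^{b_j-1/2}\big/\prod|a'_k|^{b'_k-1/2}$. For $0<\alpha\le2$ let $S_\alpha$ be a symmetric stable random variable with $E e^{itS_\alpha}=e^{-|t|^\alpha}$, $t\in\mathbb R$. For $\beta>0$ let $V_\beta$ be a positive random variable with density $e^{-x^\beta}/\Gamma(1+1/\beta)$,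 $x>0$ (so $V_1\sim\mathrm{Exp}(1)$), independent of $S_\alpha$. 1. Let $0<\alpha\le2$. The Linnik variable $X_\alpha=S_\alpha V_1^{1/\alpha}$ has characteristic function $1/(1+|t|^\alpha)$, and for all complex $s$ with $-\min(\alpha,1)<\Re s<\alpha$ the moment $E|X_\alpha|^s$ converges absolutely and $$E|X_\alpha|^s=2^s\,\frac{\Gamma\left(\frac{1+s}2\right)\Gamma\left(1+\frac s\alpha\right)\Gamma\left(1-\frac s\alpha\right)}{\sqrt\pi\,\Gamma\left(1-\frac s2\right)}.$$ Moreover $\rho_+(X_\alpha)=\alpha$ if $\alpha<2$, $\rho_+(X_2)=\infty$, $\rho_-(X_\alpha)=-\min(\alpha,1)$, and on this strip $|X_\alpha|$ has moments of Gamma type with an expression whose parameters are $\gamma=2/\alpha$, $\gamma'=1$, $\delta=1/2$, $\kappa=0$, $C_1=2\sqrt{2\pi}/\alpha$. 2. Let $0<\alpha\le2$ and $\beta>0$. The variable $X_{\alpha,\beta}=S_\alpha V_\beta^{\beta/\alpha}$ has characteristic function $(1+|t|^\alpha)^{-1/\beta}$, and for all complex $s$ with $-\min(\alpha/\beta,1)<\Re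 s<\alpha$ the moment $E|X_{\alpha,\beta}|^s$ converges absolutely and $$E|X_{\alpha,\beta}|^s=2^s\,\frac{\Gamma\left(\frac{s+1}2\right)\Gamma\left(1-\frac s\alpha\right)\Gamma\left(\frac s\alpha+\frac1\beta\right)}{\sqrt\pi\,\Gamma\left(\frac1\beta\right)\Gamma\left(1-\frac s2\right)}.$$ Moreover $\rho_+(X_{\alpha,\beta})=\alpha$ if $\alpha<2$, $\rho_+(X_{2,\beta})=\infty$, $\rho_-(X_{\alpha,\beta})=-\min(\alpha/\beta,1)$, and on this strip $|X_{\alpha,\beta}|$ has moments of Gamma type with an expression whose parameters are $\gamma=2/\alpha$, $\gamma'=1$, $\delta=1/\beta-1/2$, $\kappa=0$. 3. Let $0<\alpha<\beta\le2$. Let $T,T'$ be independent positive $\alpha/\beta$-stable variables, i.e. $T,T'>0$ almost surely and $E e^{-tT}=E e^{-tT'}=e^{-t^{\alpha/\beta}}$ for $t>0$, and put $Y_{\alpha,\beta}=(T/T')^{1/\beta}$. If $X_\beta$ is a Linnik variable as in 1 (with $\beta$ in place of $\alpha$) that is independent of $Y_{\alpha,\beta}$, then $$X_\alpha\overset{d}{=}X_\beta\,Y_{\alpha,\beta}.$$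 -/

import Mathlib

open MeasureTheory ProbabilityTheory

noncomputable section

namespace LinnikDistribution

/-- `S` is a symmetric `α`-stable random variable with `E e^{itS} = e^{-|t|^α}`. -/
structure IsSymmetricStable {Ω : Type*} [MeasurableSpace Ω] (α : ℝ) (S : Ω → ℝ)
    (μ : Measure Ω) : Prop where
  aemeasurable : AEMeasurable S μ
  charFun_eq : ∀ t : ℝ, charFun (μ.map S) t = ((Real.exp (-|t| ^ α) : ℝ) : ℂ)

/-- `T` is a positive `a`-stable random variable with `E e^{-tT} = e^{-t^a}` for `t > 0`. -/
structure IsPositiveStable {Ω : Type*} [MeasurableSpace Ω] (a : ℝ) (T : Ω → ℝ)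
    (μ : Measure Ω) : Prop where
  aemeasurable : AEMeasurable T μ
  pos : ∀ᵐ ω ∂μ, 0 < T ω
  laplace_eq : ∀ t : ℝ, 0 < t → ∫ ω, Real.exp (-(t * T ω)) ∂μ = Real.exp (-t ^ a)

/-- The law on `(0, ∞)` with density `e^{-x^β} / Γ(1 + 1/β)`. -/
def genExpMeasure (β : ℝ) : Measure ℝ :=
  (volume.restrict (Set.Ioi 0)).withDensity
    fun x => ENNReal.ofReal (Real.exp (-x ^ β) / Real.Gamma (1 + 1 / β))

/-- The Linnik variable `S V^{1/α}`. -/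
def linnik {Ω : Type*} (α : ℝ) (S V : Ω → ℝ) : Ω → ℝ :=
  fun ω => S ω * V ω ^ (1 / α)

/-- The generalized Linnik variable `S V^{β/α}`. -/
def genLinnik {Ω : Type*} (α β : ℝ) (S V : Ω → ℝ) : Ω → ℝ :=
  fun ω => S ω * V ω ^ (β / α)

/-- The Lamperti variable `L = T / T'`. -/
def lamperti {Ω : Type*} (T T' : Ω → ℝ) : Ω → ℝ :=
  fun ω => T ω / T' ω

/-- The complex absolute moment `E |X|^s`, as a Bochner integral. -/
def absMoment {Ω : Type*} [MeasurableSpace Ω] (X : Ω → ℝ) (μ : Measure Ω) (s : ℂ) : ℂ :=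
  ∫ ω, ((|X ω| : ℝ) : ℂ) ^ s ∂μ

/-- `E |X|^s` converges absolutely; a negative real part forces `X ≠ 0` almost surely. -/
def HasAbsMoment {Ω : Type*} [MeasurableSpace Ω] (X : Ω → ℝ) (μ : Measure Ω) (s : ℂ) : Prop :=
  (s.re < 0 → ∀ᵐ ω ∂μ, X ω ≠ 0) ∧ Integrable (fun ω => ((|X ω| : ℝ) : ℂ) ^ s) μ

/-- The set of real `s` with `E |X|^s < ∞`, where `0^s = ∞` for `s < 0`. -/
def finiteMoments {Ω : Type*} [MeasurableSpace Ω] (X : Ω → ℝ) (μ : Measure Ω) : Set ℝ :=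
  {s | ∫⁻ ω, ENNReal.ofReal |X ω| ^ s ∂μ < ⊤}

/-- `ρ₊ = sup {s : E |X|^s < ∞}`. -/
def rhoPlus {Ω : Type*} [MeasurableSpace Ω] (X : Ω → ℝ) (μ : Measure Ω) : EReal :=
  ⨆ s ∈ finiteMoments X μ, (s : EReal)

/-- `ρ₋ = inf {s : E |X|^s < ∞}`. -/
def rhoMinus {Ω : Type*} [MeasurableSpace Ω] (X : Ω → ℝ) (μ : Measure Ω) : EReal :=
  ⨅ s ∈ finiteMoments X μ, (s : EReal)

/-- Data of an expression `C D^s ∏ⱼ Γ(aⱼ s + bⱼ) / ∏ₖ Γ(a'ₖ s + b'ₖ)`;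
the pairs `(aⱼ, bⱼ)` are listed in `num` and the pairs `(a'ₖ, b'ₖ)` in `den`. -/
structure GammaQuotient where
  C : ℝ
  D : ℝ
  num : List (ℝ × ℝ)
  den : List (ℝ × ℝ)
  D_pos : 0 < D
  num_ne : ∀ p ∈ num, p.1 ≠ 0
  den_ne : ∀ p ∈ den, p.1 ≠ 0

namespace GammaQuotient

def eval (g : GammaQuotient) (s : ℂ) : ℂ :=
  g.C * (g.D : ℂ) ^ s * (g.num.map fun p => Complex.Gamma (p.1 * s + p.2)).prod /
    (g.den.map fun p => Complex.Gamma (p.1 * s + p.2)).prod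

/-- `γ = ∑ |aⱼ| - ∑ |a'ₖ|`. -/
def gam (g : GammaQuotient) : ℝ :=
  (g.num.map fun p => |p.1|).sum - (g.den.map fun p => |p.1|).sum

/-- `γ' = ∑ aⱼ - ∑ a'ₖ`. -/
def gam' (g : GammaQuotient) : ℝ :=
  (g.num.map fun p => p.1).sum - (g.den.map fun p => p.1).sum

/-- `δ = ∑ bⱼ - ∑ b'ₖ - (J - K) / 2`. -/
def del (g : GammaQuotient) : ℝ :=
  (g.num.map fun p => p.2).sum - (g.den.map fun p => p.2).sum
    - ((g.num.length : ℝ) - (g.den.length : ℝ)) / 2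

/-- `κ = ∑ aⱼ log |aⱼ| - ∑ a'ₖ log |a'ₖ| + log D`. -/
def kap (g : GammaQuotient) : ℝ :=
  (g.num.map fun p => p.1 * Real.log |p.1|).sum
    - (g.den.map fun p => p.1 * Real.log |p.1|).sum + Real.log g.D

/-- `C₁ = |C| (2π)^{(J - K)/2} ∏ |aⱼ|^{bⱼ - 1/2} / ∏ |a'ₖ|^{b'ₖ - 1/2}`. -/
def C₁ (g : GammaQuotient) : ℝ :=
  |g.C| * (2 * Real.pi) ^ (((g.num.length : ℝ) - (g.den.length : ℝ)) / 2)
    * (g.num.map fun p => |p.1| ^ (p.2 - 1 / 2)).prod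
    / (g.den.map fun p => |p.1| ^ (p.2 - 1 / 2)).prod

end GammaQuotient

/-- `|X|` has moments of Gamma type: `E |X|^s` is finite and equal to the Gamma quotient `g`
in the strip `lo < Re s < hi`, where no numerator or denominator factor has a pole. -/
def HasGammaMoments {Ω : Type*} [MeasurableSpace Ω] (g : GammaQuotient) (X : Ω → ℝ)
    (μ : Measure Ω) (lo hi : ℝ) : Prop :=
  lo < hi ∧ ∀ s : ℂ, lo < s.re → s.re < hi →
    (∀ p ∈ g.num ++ g.den, ∀ m : ℕ, (p.1 : ℂ) * s + p.2 ≠ -(m : ℂ)) ∧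
    HasAbsMoment X μ s ∧ absMoment X μ s = g.eval s

end LinnikDistribution

end

/-!
The proof of the moment formula works with Mellin transforms valued in `[0, ∞]`, so that finiteness
and value come out of the same identity. If `S` and `S'` are symmetric stable of indices `α` and
`β`, then exchanging the integrations in `E E' exp (i u S S')` gives
`E exp (-(u|S|)^β) = E exp (-(u|S'|)^α)` for `u > 0`. Applying `-u d/du` and then the Mellin
transform in `u` yields `E|S|^s Γ(1 - s/β) = E|S'|^s Γ(1 - s/α)` for every real `s`, where
`Γ = ∞` on `(-∞, 0]`. Choosing `β = 2`, where `S'` is Gaussian, determines `E|S|^s` together with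
the set of `s` for which it is finite, and independence brings in `V` as another Gamma factor. On
the complex strip the formula follows from the identity theorem.

The factorization compares characteristic functions. Conditioning on `L = T / T'`, it reduces to
`E 1 / (1 + c L) = 1 / (1 + c ^ a)` with `a = α / β`, and
`1 / (1 + c L) = ∫ exp (-w c T) T' exp (-w T') dw` turns the left side into
`∫ a w^(a-1) exp (-(1 + c^a) w^a) dw`.
-/

open scoped ENNReal

namespace LinnikDistribution

section Mellin

/-- The Mellin transform `∫₀^∞ u ^ (r - 1) f(u) du` of a nonnegative function, with values in
`[0, ∞]`, so that it is defined for every real `r`. -/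
noncomputable def lmellin (f : ℝ → ℝ≥0∞) (r : ℝ) : ℝ≥0∞ :=
  ∫⁻ u in Set.Ioi 0, ENNReal.ofReal (u ^ (r - 1)) * f u

/-- Euler's integral `∫₀^∞ t ^ (x - 1) e ^ (-t) dt` with values in `[0, ∞]`: unlike `Real.Gamma`, it
is `∞` on the half-line `x ≤ 0`. -/
noncomputable def lGamma (x : ℝ) : ℝ≥0∞ :=
  lmellin (fun t => ENNReal.ofReal (Real.exp (-t))) x

lemma lmellin_comp_mul_left (f : ℝ → ℝ≥0∞) (r : ℝ) {y : ℝ} (hy : 0 < y) :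
    lmellin (fun u => f (y * u)) r = ENNReal.ofReal (y ^ (-r)) * lmellin f r := by
  have himage : (y * ·) '' Set.Ioi (0 : ℝ) = Set.Ioi 0 := by simp [Set.image_mul_left_Ioi hy]
  have hsub := lintegral_image_eq_lintegral_abs_deriv_mul (s := Set.Ioi 0) measurableSet_Ioi
    (fun u _ => ((hasDerivAt_id u).const_mul y).hasDerivWithinAt)
    (mul_right_injective₀ hy.ne').injOn fun u => ENNReal.ofReal (u ^ (r - 1)) * f u
  simp only [id_eq, himage] at hsub
  unfold lmellin
  rw [hsub, ← lintegral_const_mul' _ _ ENNReal.ofReal_ne_top]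
  refine setLIntegral_congr_fun measurableSet_Ioi fun u (hu : 0 < u) => ?_
  simp only [mul_one, abs_of_pos hy, ← mul_assoc]
  rw [← ENNReal.ofReal_mul (by positivity), ← ENNReal.ofReal_mul (by positivity),
    Real.mul_rpow hy.le hu.le, ← mul_assoc, ← Real.rpow_add_one hy.ne', ← Real.rpow_add hy]
  simp

lemma lmellin_comp_rpow (f : ℝ → ℝ≥0∞) (r : ℝ) {p : ℝ} (hp : 0 < p) :
    lmellin (fun u => f (u ^ p)) r = ENNReal.ofReal p⁻¹ * lmellin f (r / p) := by
  have himage : (fun u : ℝ => u ^ p) '' Set.Ioi 0 = Set.Ioi 0 := by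
    refine Set.Subset.antisymm (Set.image_subset_iff.2 fun u hu => Real.rpow_pos_of_pos hu p)
      fun v (hv : 0 < v) => ⟨v ^ p⁻¹, Real.rpow_pos_of_pos hv _, Real.rpow_inv_rpow hv.le hp.ne'⟩
  have hsub := lintegral_image_eq_lintegral_abs_deriv_mul measurableSet_Ioi
    (fun u hu => (Real.hasDerivAt_rpow_const (p := p) (.inl (ne_of_gt hu))).hasDerivWithinAt)
    ((Real.rpow_left_injOn hp.ne').mono Set.Ioi_subset_Ici_self)
    fun u => ENNReal.ofReal (u ^ (r / p - 1)) * f u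
  rw [himage] at hsub
  unfold lmellin
  rw [hsub, ← lintegral_const_mul' _ _ ENNReal.ofReal_ne_top]
  refine setLIntegral_congr_fun measurableSet_Ioi fun u (hu : 0 < u) => ?_
  have hexponent : p - 1 + p * (r / p - 1) = r - 1 := by field_simp; ring
  simp only [← mul_assoc]
  rw [abs_of_pos (by positivity), ← ENNReal.ofReal_mul (by positivity),
    ← ENNReal.ofReal_mul (by positivity), ← mul_assoc, inv_mul_cancel₀ hp.ne', one_mul,
    ← Real.rpow_mul hu.le, ← Real.rpow_add hu, hexponent]

lemma lGamma_of_pos {x : ℝ} (hx : 0 < x) : lGamma x = ENNReal.ofReal (Real.Gamma x) := by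
  unfold lGamma lmellin
  rw [Real.Gamma_eq_integral hx,
    ofReal_integral_eq_lintegral_ofReal (Real.GammaIntegral_convergent hx)
    (ae_restrict_of_forall_mem measurableSet_Ioi fun t (ht : 0 < t) => by positivity)]
  refine setLIntegral_congr_fun measurableSet_Ioi fun t (ht : 0 < t) => ?_
  simp only
  rw [← ENNReal.ofReal_mul (by positivity), mul_comm]

lemma lGamma_of_nonpos {x : ℝ} (hx : x ≤ 0) : lGamma x = ∞ := by
  have hpow : ∫⁻ t in Set.Ioo 0 1, ENNReal.ofReal (t ^ (x - 1)) = ∞ := by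
    by_contra hfin
    refine hx.not_gt (by_contra fun _ => ?_)
    have := (lintegral_ofReal_ne_top_iff_integrable (by fun_prop)
      (ae_restrict_of_forall_mem measurableSet_Ioo fun t ht => Real.rpow_nonneg ht.1.le _)).1 hfin
    have := (intervalIntegral.integrableOn_Ioo_rpow_iff one_pos).1 this
    linarith
  have hle : ∫⁻ t in Set.Ioo (0 : ℝ) 1,
      ENNReal.ofReal (t ^ (x - 1)) * ENNReal.ofReal (Real.exp (-1)) ≤ lGamma x := by
    refine (setLIntegral_mono' measurableSet_Ioo fun t ht => ?_).trans
      (lintegral_mono_set Set.Ioo_subset_Ioi_self)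
    exact mul_le_mul_right (ENNReal.ofReal_le_ofReal (Real.exp_le_exp.2 (neg_le_neg ht.2.le))) _
  rw [lintegral_mul_const' _ _ ENNReal.ofReal_ne_top, hpow,
    ENNReal.top_mul (by simp [Real.exp_pos])] at hle
  exact top_le_iff.1 hle

lemma lGamma_ne_zero (x : ℝ) : lGamma x ≠ 0 := by
  rcases le_or_gt x 0 with hx | hx
  · simp [lGamma_of_nonpos hx]
  · simp [lGamma_of_pos hx, Real.Gamma_pos_of_pos hx]

lemma lGamma_lt_top_iff {x : ℝ} : lGamma x < ∞ ↔ 0 < x := by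
  refine ⟨fun h => ?_, fun hx => by simp [lGamma_of_pos hx]⟩
  contrapose! h
  simp [lGamma_of_nonpos h]

lemma lmellin_exp_neg_rpow (r : ℝ) {p : ℝ} (hp : 0 < p) :
    lmellin (fun u => ENNReal.ofReal (Real.exp (-u ^ p))) r
      = ENNReal.ofReal p⁻¹ * lGamma (r / p) :=
  lmellin_comp_rpow (fun t => ENNReal.ofReal (Real.exp (-t))) r hp

/-- The function `p x ^ p e ^ (-x ^ p) = -x d/dx e ^ (-x ^ p)`. Unlike `e ^ (-x ^ p)` it vanishes at
`0`, so that its Mellin transform is finite on both sides of `0`. -/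
noncomputable def rpowExpKernel (p x : ℝ) : ℝ :=
  p * x ^ p * Real.exp (-x ^ p)

lemma rpowExpKernel_nonneg {p x : ℝ} (hp : 0 ≤ p) (hx : 0 ≤ x) : 0 ≤ rpowExpKernel p x := by
  unfold rpowExpKernel
  positivity

@[fun_prop]
lemma measurable_rpowExpKernel (p : ℝ) : Measurable (rpowExpKernel p) := by
  unfold rpowExpKernel
  fun_prop

lemma lmellin_rpowExpKernel (r : ℝ) {p : ℝ} (hp : 0 < p) :
    lmellin (fun u => ENNReal.ofReal (rpowExpKernel p u)) r = lGamma (1 + r / p) := by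
  have h := lmellin_comp_rpow (fun t => ENNReal.ofReal (p * t * Real.exp (-t))) r hp
  refine h.trans ?_
  unfold lGamma lmellin
  rw [← lintegral_const_mul' _ _ ENNReal.ofReal_ne_top]
  refine setLIntegral_congr_fun measurableSet_Ioi fun t (ht : 0 < t) => ?_
  simp only
  rw [← ENNReal.ofReal_mul (by positivity), ← ENNReal.ofReal_mul (by positivity),
    ← ENNReal.ofReal_mul (by positivity), add_sub_cancel_left]
  congr 1
  rw [Real.rpow_sub_one ht.ne']
  field_simp

end Mellin

section AbsoluteMoments

variable {Ω : Type*} [MeasurableSpace Ω] {μ : Measure Ω} {X Y : Ω → ℝ} {s : ℝ}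

/-- The absolute moment `E |X| ^ s` with values in `[0, ∞]`, where `0 ^ s = ∞` for `s < 0`. -/
noncomputable def labsMoment (X : Ω → ℝ) (μ : Measure Ω) (s : ℝ) : ℝ≥0∞ :=
  ∫⁻ ω, ENNReal.ofReal |X ω| ^ s ∂μ

lemma mem_finiteMoments_iff : s ∈ finiteMoments X μ ↔ labsMoment X μ s < ∞ :=
  Iff.rfl

lemma labsMoment_map (hX : AEMeasurable X μ) (s : ℝ) :
    labsMoment id (μ.map X) s = labsMoment X μ s :=
  lintegral_map' (by fun_prop) hX

lemma labsMoment_mul_of_indepFun (hX : AEMeasurable X μ) (hY : AEMeasurable Y μ)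
    (h : IndepFun X Y μ) (s : ℝ) :
    labsMoment (fun ω => X ω * Y ω) μ s = labsMoment X μ s * labsMoment Y μ s := by
  refine Eq.trans (lintegral_congr fun ω => ?_)
    (lintegral_mul_eq_lintegral_mul_lintegral_of_indepFun'' (by fun_prop) (by fun_prop)
      (h.comp (φ := fun x => ENNReal.ofReal |x| ^ s) (ψ := fun y => ENNReal.ofReal |y| ^ s)
        (by fun_prop) (by fun_prop)))
  simp only [abs_mul, ENNReal.ofReal_mul (abs_nonneg _),
    ENNReal.mul_rpow_of_ne_top ENNReal.ofReal_ne_top ENNReal.ofReal_ne_top]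

lemma labsMoment_rpow (hY : ∀ᵐ ω ∂μ, 0 < Y ω) (c s : ℝ) :
    labsMoment (fun ω => Y ω ^ c) μ s = labsMoment Y μ (c * s) := by
  refine lintegral_congr_ae (hY.mono fun ω hω => ?_)
  have hωc := Real.rpow_pos_of_pos hω c
  simp only [abs_of_pos hω, abs_of_pos hωc, ENNReal.ofReal_rpow_of_pos hω,
    ENNReal.ofReal_rpow_of_pos hωc, ← Real.rpow_mul hω.le]

lemma labsMoment_ne_zero [NeZero μ] (hX : AEMeasurable X μ) (h0 : ∀ᵐ ω ∂μ, X ω ≠ 0) (s : ℝ) :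
    labsMoment X μ s ≠ 0 := by
  intro h
  have hzero := (lintegral_eq_zero_iff' (by fun_prop)).1 h
  obtain ⟨ω, hω, hω'⟩ := (h0.and hzero).exists
  simp [ENNReal.rpow_eq_zero_iff, hω] at hω'

lemma labsMoment_mul_lmellin [SFinite μ] (hX : AEMeasurable X μ) (h0 : ∀ᵐ ω ∂μ, X ω ≠ 0)
    {f : ℝ → ℝ≥0∞} (hf : Measurable f) (s : ℝ) :
    labsMoment X μ s * lmellin f (-s) = lmellin (fun u => ∫⁻ ω, f (u * |X ω|) ∂μ) (-s) := by
  have hswap : AEMeasurable (Function.uncurry fun (u : ℝ) ω =>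
      ENNReal.ofReal (u ^ (-s - 1)) * f (u * |X ω|)) ((volume.restrict (Set.Ioi 0)).prod μ) := by
    have : AEMeasurable (fun p : ℝ × Ω => X p.2) ((volume.restrict (Set.Ioi 0)).prod μ) :=
      hX.comp_snd
    simp only [Function.uncurry_def]
    fun_prop
  calc labsMoment X μ s * lmellin f (-s)
      = ∫⁻ ω, ENNReal.ofReal |X ω| ^ s * lmellin f (-s) ∂μ :=
        (lintegral_mul_const'' _ (by fun_prop)).symm
    _ = ∫⁻ ω, lmellin (fun u => f (|X ω| * u)) (-s) ∂μ := by
        refine lintegral_congr_ae (h0.mono fun ω hω => ?_)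
        simp only [lmellin_comp_mul_left f _ (abs_pos.2 hω), neg_neg,
          ENNReal.ofReal_rpow_of_pos (abs_pos.2 hω)]
    _ = lmellin (fun u => ∫⁻ ω, f (u * |X ω|) ∂μ) (-s) := by
        simp only [lmellin, mul_comm |X _|]
        rw [← lintegral_lintegral_swap hswap]
        simp_rw [lintegral_const_mul' _ _ ENNReal.ofReal_ne_top]

lemma zero_mem_finiteMoments [IsFiniteMeasure μ] : 0 ∈ finiteMoments X μ := by
  simp [finiteMoments]

lemma ordConnected_finiteMoments (hX : AEMeasurable X μ) : (finiteMoments X μ).OrdConnected := by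
  refine ⟨fun s hs u hu t ht => ?_⟩
  have hle : labsMoment X μ t ≤ labsMoment X μ s + labsMoment X μ u := by
    unfold labsMoment
    rw [← lintegral_add_left' (by fun_prop)]
    refine lintegral_mono fun ω => ?_
    rcases le_total (ENNReal.ofReal |X ω|) 1 with h | h
    · exact (ENNReal.rpow_le_rpow_of_exponent_ge h ht.1).trans le_self_add
    · exact (ENNReal.rpow_le_rpow_of_exponent_le h ht.2).trans le_add_self
  exact hle.trans_lt (ENNReal.add_lt_top.2 ⟨hs, hu⟩)

lemma rhoPlus_of_finiteMoments_eq_Ioo {a b : ℝ} (hab : a < b)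
    (h : finiteMoments X μ = Set.Ioo a b) : rhoPlus X μ = b := by
  rw [rhoPlus, h, ← sSup_image, EReal.image_coe_Ioo, csSup_Ioo (by exact_mod_cast hab)]

lemma rhoPlus_of_finiteMoments_eq_Ioi {a : ℝ} (h : finiteMoments X μ = Set.Ioi a) :
    rhoPlus X μ = ⊤ := by
  rw [rhoPlus, h, ← sSup_image, EReal.image_coe_Ioi, csSup_Ioo (EReal.coe_lt_top a)]

lemma rhoMinus_of_finiteMoments_eq_Ioo {a b : ℝ} (hab : a < b)
    (h : finiteMoments X μ = Set.Ioo a b) : rhoMinus X μ = a := by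
  rw [rhoMinus, h, ← sInf_image, EReal.image_coe_Ioo, csInf_Ioo (by exact_mod_cast hab)]

lemma rhoMinus_of_finiteMoments_eq_Ioi {a : ℝ} (h : finiteMoments X μ = Set.Ioi a) :
    rhoMinus X μ = a := by
  rw [rhoMinus, h, ← sInf_image, EReal.image_coe_Ioi, csInf_Ioo (EReal.coe_lt_top a)]

end AbsoluteMoments

section CharFun

open scoped RealInnerProductSpace in
lemma integral_charFun_smul_comm {E : Type*} [NormedAddCommGroup E] [InnerProductSpace ℝ E]
    [MeasurableSpace E] [BorelSpace E] [SecondCountableTopology E] (P Q : Measure E)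
    [IsFiniteMeasure P] [IsFiniteMeasure Q] (u : ℝ) :
    ∫ x, charFun Q (u • x) ∂P = ∫ y, charFun P (u • y) ∂Q := by
  have hexp : Integrable (Function.uncurry fun x y : E => Complex.exp (⟪y, u • x⟫ * Complex.I))
      (P.prod Q) := by
    refine Integrable.of_bound (C := 1) (Continuous.aestronglyMeasurable ?_)
      (ae_of_all _ fun p => (Complex.norm_exp_ofReal_mul_I _).le)
    simp only [Function.uncurry_def]
    fun_prop
  simp only [charFun_apply]
  rw [integral_integral_swap hexp]
  simp only [inner_smul_right, real_inner_comm]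

lemma charFun_mul_of_indepFun {Ω : Type*} [MeasurableSpace Ω] {μ : Measure Ω}
    [IsFiniteMeasure μ] {X Y : Ω → ℝ} (hX : AEMeasurable X μ) (hY : AEMeasurable Y μ)
    (h : IndepFun X Y μ) (t : ℝ) :
    charFun (μ.map fun ω => X ω * Y ω) t = ∫ ω, charFun (μ.map X) (t * Y ω) ∂μ := by
  have hexp : Integrable (fun p : ℝ × ℝ => Complex.exp (t * (p.1 * p.2 : ℝ) * Complex.I))
      ((μ.map X).prod (μ.map Y)) := by
    refine Integrable.of_bound (C := 1) (Continuous.aestronglyMeasurable (by fun_prop))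
      (ae_of_all _ fun p => ?_)
    rw [← Complex.ofReal_mul, Complex.norm_exp_ofReal_mul_I]
  have hmap : μ.map (fun ω => X ω * Y ω)
      = ((μ.map X).prod (μ.map Y)).map fun p => p.1 * p.2 := by
    rw [← (indepFun_iff_map_prod_eq_prod_map_map hX hY).1 h,
      AEMeasurable.map_map_of_aemeasurable (by fun_prop) (by fun_prop)]
    rfl
  calc charFun (μ.map fun ω => X ω * Y ω) t
      = ∫ p : ℝ × ℝ, Complex.exp (t * (p.1 * p.2 : ℝ) * Complex.I)
          ∂((μ.map X).prod (μ.map Y)) := by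
        rw [hmap, charFun_apply_real, integral_map (by fun_prop) (by fun_prop)]
    _ = ∫ y, charFun (μ.map X) (t * y) ∂(μ.map Y) := by
        rw [integral_prod_symm _ hexp]
        simp only [charFun_apply_real]
        push_cast
        simp only [mul_left_comm, mul_comm]
    _ = ∫ ω, charFun (μ.map X) (t * Y ω) ∂μ :=
        integral_map hY (Measurable.aestronglyMeasurable (by fun_prop))

end CharFun

section Laplace

variable {Ω : Type*} [MeasurableSpace Ω] {μ : Measure Ω} [IsFiniteMeasure μ] {X Y : Ω → ℝ}

lemma integrable_exp_neg_mul (hY : AEMeasurable Y μ) (hpos : ∀ᵐ ω ∂μ, 0 ≤ Y ω) {w : ℝ}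
    (hw : 0 ≤ w) : Integrable (fun ω => Real.exp (-(w * Y ω))) μ := by
  refine Integrable.of_bound (C := 1) (AEMeasurable.aestronglyMeasurable (by fun_prop)) ?_
  filter_upwards [hpos] with ω hω
  rw [Real.norm_of_nonneg (Real.exp_nonneg _), Real.exp_le_one_iff, neg_nonpos]
  positivity

lemma neg_mem_interior_integrableExpSet (hY : AEMeasurable Y μ) (hpos : ∀ᵐ ω ∂μ, 0 ≤ Y ω)
    {w : ℝ} (hw : 0 < w) : -w ∈ interior (integrableExpSet Y μ) := by
  refine interior_maximal (t := Set.Iio 0) (fun t (ht : t < 0) => ?_) isOpen_Iio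
    (neg_lt_zero.2 hw)
  simpa [integrableExpSet] using! integrable_exp_neg_mul hY hpos (neg_nonneg.2 ht.le)

lemma hasDerivAt_integral_exp_neg_mul (hY : AEMeasurable Y μ) (hpos : ∀ᵐ ω ∂μ, 0 ≤ Y ω)
    {w : ℝ} (hw : 0 < w) :
    HasDerivAt (fun w => ∫ ω, Real.exp (-(w * Y ω)) ∂μ)
      (-∫ ω, Y ω * Real.exp (-(w * Y ω)) ∂μ) w := by
  have h := (hasDerivAt_mgf (neg_mem_interior_integrableExpSet hY hpos hw)).comp w
    (hasDerivAt_neg w)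
  simpa [Function.comp_def, mgf] using! h

lemma integrable_mul_exp_neg_mul (hY : AEMeasurable Y μ) (hpos : ∀ᵐ ω ∂μ, 0 ≤ Y ω)
    {w : ℝ} (hw : 0 < w) : Integrable (fun ω => Y ω * Real.exp (-(w * Y ω))) μ := by
  simpa using integrable_pow_mul_exp_of_mem_interior_integrableExpSet
    (neg_mem_interior_integrableExpSet hY hpos hw) 1

lemma tendsto_integral_exp_neg_rpow_atTop (hX : AEMeasurable X μ) {p : ℝ} (hp : 0 < p) :
    Filter.Tendsto (fun u : ℝ => ∫ ω, Real.exp (-(u * |X ω|) ^ p) ∂μ) Filter.atTop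
      (nhds (μ.real {ω | X ω = 0})) := by
  have hzero : NullMeasurableSet {ω | X ω = 0} μ := hX.nullMeasurable (measurableSet_singleton 0)
  have hlim : ∫ ω, Set.indicator {ω | X ω = 0} 1 ω ∂μ = μ.real {ω | X ω = 0} := by
    rw [integral_indicator₀ hzero]
    simp
  rw [← hlim]
  refine tendsto_integral_filter_of_dominated_convergence (fun _ => 1)
    (.of_forall fun u => AEMeasurable.aestronglyMeasurable (by fun_prop)) ?_
    (integrable_const 1) (ae_of_all _ fun ω => ?_)
  · filter_upwards [Filter.eventually_ge_atTop 0] with u hu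
    refine ae_of_all _ fun ω => ?_
    rw [Real.norm_of_nonneg (Real.exp_nonneg _), Real.exp_le_one_iff, neg_nonpos]
    positivity
  · rcases eq_or_ne (X ω) 0 with hω | hω
    · simp [hω, Real.zero_rpow hp.ne']
    · have : Filter.Tendsto (fun u => (u * |X ω|) ^ p) Filter.atTop Filter.atTop :=
        (tendsto_rpow_atTop hp).comp
          (Filter.tendsto_id.atTop_mul_const (abs_pos.2 hω))
      simpa only [Set.indicator, Set.mem_ofPred_eq, hω, if_false] using!
        Real.tendsto_exp_neg_atTop_nhds_zero.comp this

lemma hasDerivAt_integral_exp_neg_rpow (hX : AEMeasurable X μ) {p u : ℝ} (hu : 0 < u) :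
    HasDerivAt (fun u => ∫ ω, Real.exp (-(u * |X ω|) ^ p) ∂μ)
      (-(∫ ω, rpowExpKernel p (u * |X ω|) ∂μ) / u) u := by
  have hdecomp : ∀ {v : ℝ}, 0 < v → ∀ ω, (v * |X ω|) ^ p = v ^ p * |X ω| ^ p := fun hv ω =>
    Real.mul_rpow hv.le (abs_nonneg _)
  have h := (hasDerivAt_integral_exp_neg_mul (μ := μ) (Y := fun ω => |X ω| ^ p) (by fun_prop)
    (ae_of_all _ fun ω => by positivity) (Real.rpow_pos_of_pos hu p)).comp u
    (Real.hasDerivAt_rpow_const (p := p) (.inl hu.ne'))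
  refine (h.congr_of_eventuallyEq ?_).congr_deriv ?_
  · filter_upwards [lt_mem_nhds hu] with v hv
    simp only [hdecomp hv, Function.comp_apply]
  · simp only [rpowExpKernel, hdecomp hu, Real.rpow_sub_one hu.ne', mul_assoc,
      integral_const_mul]
    ring

lemma integrable_rpowExpKernel (hX : AEMeasurable X μ) (p : ℝ) {u : ℝ} (hu : 0 < u) :
    Integrable (fun ω => rpowExpKernel p (u * |X ω|)) μ := by
  have h := (integrable_mul_exp_neg_mul (μ := μ) (Y := fun ω => (u * |X ω|) ^ p) (by fun_prop)
    (ae_of_all _ fun ω => by positivity) one_pos).const_mul p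
  simpa only [rpowExpKernel, one_mul, mul_assoc] using! h

end Laplace

lemma isSymmetricStable_gaussianReal : IsSymmetricStable 2 id (gaussianReal 0 2) := by
  refine ⟨aemeasurable_id, fun t => ?_⟩
  rw [Measure.map_id, charFun_gaussianReal]
  simp

namespace IsSymmetricStable

variable {Ω Ω' : Type*} [MeasurableSpace Ω] [MeasurableSpace Ω'] {μ : Measure Ω} {ν : Measure Ω'}
  [IsProbabilityMeasure μ] [IsProbabilityMeasure ν] {α β : ℝ} {S : Ω → ℝ} {S' : Ω' → ℝ}

lemma integral_exp_neg_rpow_comm (hS : IsSymmetricStable α S μ) (hS' : IsSymmetricStable β S' ν)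
    {u : ℝ} (hu : 0 < u) :
    ∫ ω, Real.exp (-(u * |S ω|) ^ β) ∂μ = ∫ ω, Real.exp (-(u * |S' ω|) ^ α) ∂ν := by
  have h := integral_charFun_smul_comm (μ.map S) (ν.map S') u
  simp only [hS.charFun_eq, hS'.charFun_eq, smul_eq_mul, abs_mul, abs_of_pos hu,
    integral_complex_ofReal, Complex.ofReal_inj] at h
  rwa [integral_map hS.aemeasurable (Measurable.aestronglyMeasurable (by fun_prop)),
    integral_map hS'.aemeasurable (Measurable.aestronglyMeasurable (by fun_prop))] at h

lemma ae_ne_zero (hα : 0 < α) (hS : IsSymmetricStable α S μ) : ∀ᵐ ω ∂μ, S ω ≠ 0 := by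
  have hlim := tendsto_integral_exp_neg_rpow_atTop hS.aemeasurable (two_pos (α := ℝ))
  have hgauss := tendsto_integral_exp_neg_rpow_atTop (μ := gaussianReal 0 2) aemeasurable_id hα
  have hcomm : (fun u => ∫ ω, Real.exp (-(u * |S ω|) ^ (2 : ℝ)) ∂μ) =ᶠ[Filter.atTop]
      fun u => ∫ x, Real.exp (-(u * |id x|) ^ α) ∂(gaussianReal 0 2) := by
    filter_upwards [Filter.eventually_gt_atTop 0] with u hu
    exact hS.integral_exp_neg_rpow_comm isSymmetricStable_gaussianReal hu
  have hzero := tendsto_nhds_unique (hlim.congr' hcomm) hgauss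
  have := nullSingletonClass_gaussianReal (μ := 0) (v := 2) two_ne_zero
  simpa [ae_iff, measureReal_def, ENNReal.toReal_eq_zero_iff] using hzero

lemma lintegral_rpowExpKernel_comm (hα : 0 ≤ α) (hβ : 0 ≤ β) (hS : IsSymmetricStable α S μ)
    (hS' : IsSymmetricStable β S' ν) {u : ℝ} (hu : 0 < u) :
    ∫⁻ ω, ENNReal.ofReal (rpowExpKernel β (u * |S ω|)) ∂μ
      = ∫⁻ ω, ENNReal.ofReal (rpowExpKernel α (u * |S' ω|)) ∂ν := by
  have hderiv := hasDerivAt_integral_exp_neg_rpow (p := α) hS'.aemeasurable hu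
  have heq : (fun u => ∫ ω, Real.exp (-(u * |S ω|) ^ β) ∂μ) =ᶠ[nhds u]
      fun u => ∫ ω, Real.exp (-(u * |S' ω|) ^ α) ∂ν := by
    filter_upwards [lt_mem_nhds hu] with v hv using hS.integral_exp_neg_rpow_comm hS' hv
  have h := (hasDerivAt_integral_exp_neg_rpow hS.aemeasurable hu).unique
    (hderiv.congr_of_eventuallyEq heq)
  rw [div_left_inj' hu.ne', neg_inj] at h
  rw [← ofReal_integral_eq_lintegral_ofReal (integrable_rpowExpKernel hS.aemeasurable β hu)
      (ae_of_all _ fun ω => rpowExpKernel_nonneg hβ (by positivity)), h,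
    ofReal_integral_eq_lintegral_ofReal (integrable_rpowExpKernel hS'.aemeasurable α hu)
      (ae_of_all _ fun ω => rpowExpKernel_nonneg hα (by positivity))]

lemma labsMoment_mul_lGamma_comm (hα : 0 < α) (hβ : 0 < β) (hS : IsSymmetricStable α S μ)
    (hS' : IsSymmetricStable β S' ν) (s : ℝ) :
    labsMoment S μ s * lGamma (1 - s / β) = labsMoment S' ν s * lGamma (1 - s / α) := by
  have hmellin : ∀ {p : ℝ}, 0 < p →
      lGamma (1 - s / p) = lmellin (fun u => ENNReal.ofReal (rpowExpKernel p u)) (-s) :=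
    fun hp => by rw [lmellin_rpowExpKernel _ hp, neg_div, sub_eq_add_neg]
  rw [hmellin hα, hmellin hβ,
    labsMoment_mul_lmellin hS.aemeasurable (hS.ae_ne_zero hα) (by fun_prop),
    labsMoment_mul_lmellin hS'.aemeasurable (hS'.ae_ne_zero hβ) (by fun_prop)]
  exact setLIntegral_congr_fun measurableSet_Ioi fun u (hu : 0 < u) => by
    simp only [hS.lintegral_rpowExpKernel_comm hα.le hβ.le hS' hu]

end IsSymmetricStable

section Gaussian

lemma lintegral_comp_abs (f : ℝ → ℝ≥0∞) :
    ∫⁻ x, f |x| = 2 * ∫⁻ x in Set.Ioi (0 : ℝ), f x := by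
  have hpos : ∫⁻ x in Set.Ioi (0 : ℝ), f |x| = ∫⁻ x in Set.Ioi (0 : ℝ), f x :=
    setLIntegral_congr_fun measurableSet_Ioi fun x (hx : 0 < x) => by rw [abs_of_pos hx]
  have hneg : ∫⁻ x in Set.Iic (0 : ℝ), f |x| = ∫⁻ x in Set.Ioi (0 : ℝ), f |x| := by
    have h := (Measure.measurePreserving_neg (volume : Measure ℝ)).setLIntegral_comp_preimage_emb
      (MeasurableEquiv.neg ℝ).measurableEmbedding (fun x => f |x|) (Set.Iic (0 : ℝ))
    simpa [setLIntegral_congr Ioi_ae_eq_Ici] using h.symm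
  rw [← lintegral_add_compl _ (measurableSet_Ioi (a := (0 : ℝ))), Set.compl_Ioi, hneg, hpos,
    two_mul]

lemma labsMoment_gaussianReal {v : NNReal} (hv : v ≠ 0) (s : ℝ) :
    labsMoment id (gaussianReal 0 v) s
      = ENNReal.ofReal (√(2 * v) ^ s / √Real.pi) * lGamma ((s + 1) / 2) := by
  set c : ℝ := √(2 * v) with hc
  have hcpos : 0 < c := by positivity
  have hdensity : ∀ x, gaussianPDF 0 v x = ENNReal.ofReal (c * √Real.pi)⁻¹
      * ENNReal.ofReal (Real.exp (-(c⁻¹ * |x|) ^ (2 : ℝ))) := fun x => by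
    have hexponent : -(x - 0) ^ 2 / (2 * v) = -(c⁻¹ * |x|) ^ (2 : ℝ) := by
      rw [Real.rpow_two, mul_pow, sq_abs, inv_pow, hc, Real.sq_sqrt (by positivity), sub_zero]
      ring
    rw [gaussianPDF, gaussianPDFReal, hexponent, ← ENNReal.ofReal_mul (by positivity), hc,
      ← Real.sqrt_mul (by positivity), mul_right_comm]
  calc labsMoment id (gaussianReal 0 v) s
      = ∫⁻ x : ℝ, gaussianPDF 0 v x * ENNReal.ofReal |x| ^ s := by
        unfold labsMoment
        rw [gaussianReal_of_var_ne_zero _ hv,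
          lintegral_withDensity_eq_lintegral_mul _ (measurable_gaussianPDF _ _) (by fun_prop)]
        rfl
    _ = 2 * (ENNReal.ofReal (c * √Real.pi)⁻¹ *
          lmellin (fun u => ENNReal.ofReal (Real.exp (-(c⁻¹ * u) ^ (2 : ℝ)))) (s + 1)) := by
        simp only [hdensity, mul_assoc]
        rw [lintegral_const_mul' _ _ ENNReal.ofReal_ne_top, lintegral_comp_abs fun x =>
          ENNReal.ofReal (Real.exp (-(c⁻¹ * x) ^ (2 : ℝ))) * ENNReal.ofReal x ^ s, mul_left_comm]
        congr 2
        refine setLIntegral_congr_fun measurableSet_Ioi fun x (hx : 0 < x) => ?_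
        simp only [ENNReal.ofReal_rpow_of_pos hx, add_sub_cancel_right, mul_comm]
    _ = ENNReal.ofReal (c ^ s / √Real.pi) * lGamma ((s + 1) / 2) := by
        rw [lmellin_comp_mul_left (fun u => ENNReal.ofReal (Real.exp (-u ^ (2 : ℝ)))) _
            (inv_pos.2 hcpos), lmellin_exp_neg_rpow _ two_pos, ← mul_assoc, ← mul_assoc,
          ← mul_assoc, ← ENNReal.ofReal_ofNat, ← ENNReal.ofReal_mul (by positivity),
          ← ENNReal.ofReal_mul (by positivity), ← ENNReal.ofReal_mul (by positivity),
          Real.inv_rpow hcpos.le, Real.rpow_neg hcpos.le, Real.rpow_add_one hcpos.ne']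
        congr 2
        field_simp

end Gaussian

section GenExp

variable {β : ℝ}

lemma ae_pos_genExpMeasure : ∀ᵐ x ∂(genExpMeasure β), 0 < x :=
  (withDensity_absolutelyContinuous _ _).ae_le (ae_restrict_mem measurableSet_Ioi)

lemma expMeasure_one_eq_genExpMeasure : expMeasure 1 = genExpMeasure 1 := by
  unfold expMeasure gammaMeasure genExpMeasure
  rw [← withDensity_indicator measurableSet_Ioi]
  refine withDensity_congr_ae ?_
  filter_upwards [Measure.ae_ne volume 0] with x hx
  rcases lt_or_gt_of_ne hx with h | h
  · simp [gammaPDF, gammaPDFReal, h.not_ge, h.le]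
  · simp [gammaPDF, gammaPDFReal, h.le, h, one_add_one_eq_two]

lemma integral_exp_neg_mul_rpow_genExpMeasure (hβ : 0 < β) {c : ℝ} (hc : -1 < c) :
    ∫ x, Real.exp (-(c * x ^ β)) ∂(genExpMeasure β) = 1 / (1 + c) ^ (1 / β) := by
  have : 0 < Real.Gamma (1 + 1 / β) := Real.Gamma_pos_of_pos (by positivity)
  have hdensity : ∀ x : ℝ, (ENNReal.ofReal (Real.exp (-x ^ β) / Real.Gamma (1 + 1 / β))).toReal •
      Real.exp (-(c * x ^ β))
      = (Real.Gamma (1 + 1 / β))⁻¹ * Real.exp (-(1 + c) * x ^ β) := by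
    intro x
    rw [ENNReal.toReal_ofReal (by positivity), smul_eq_mul, div_mul_eq_mul_div, ← Real.exp_add]
    ring_nf
  unfold genExpMeasure
  rw [integral_withDensity_eq_integral_toReal_smul (by fun_prop)
    (ae_of_all _ fun x => ENNReal.ofReal_lt_top)]
  simp_rw [hdensity]
  rw [integral_const_mul, integral_exp_neg_mul_rpow hβ (by linarith), add_comm (1 / β), neg_div,
    Real.rpow_neg (by linarith)]
  field_simp

lemma labsMoment_genExpMeasure (hβ : 0 < β) (s : ℝ) :
    labsMoment id (genExpMeasure β) s
      = ENNReal.ofReal (Real.Gamma (1 / β))⁻¹ * lGamma ((s + 1) / β) := by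
  have hΓ : Real.Gamma (1 + 1 / β) = 1 / β * Real.Gamma (1 / β) := by
    rw [add_comm, Real.Gamma_add_one (by positivity)]
  have : 0 < Real.Gamma (1 / β) := Real.Gamma_pos_of_pos (by positivity)
  calc labsMoment id (genExpMeasure β) s
      = ∫⁻ x in Set.Ioi 0, ENNReal.ofReal (Real.exp (-x ^ β) / Real.Gamma (1 + 1 / β))
          * ENNReal.ofReal |x| ^ s := by
        unfold labsMoment genExpMeasure
        rw [lintegral_withDensity_eq_lintegral_mul _ (by fun_prop) (by fun_prop)]
        rfl
    _ = ENNReal.ofReal (Real.Gamma (1 + 1 / β))⁻¹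
          * lmellin (fun x => ENNReal.ofReal (Real.exp (-x ^ β))) (s + 1) := by
        unfold lmellin
        rw [← lintegral_const_mul' _ _ ENNReal.ofReal_ne_top]
        refine setLIntegral_congr_fun measurableSet_Ioi fun x (hx : 0 < x) => ?_
        simp only
        rw [abs_of_pos hx, ENNReal.ofReal_rpow_of_pos hx, add_sub_cancel_right,
          ENNReal.ofReal_div_of_pos (by rw [hΓ]; positivity),
          ENNReal.ofReal_inv_of_pos (by rw [hΓ]; positivity), ENNReal.div_eq_inv_mul, mul_assoc,
          mul_comm (ENNReal.ofReal (Real.exp _))]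
    _ = ENNReal.ofReal (Real.Gamma (1 / β))⁻¹ * lGamma ((s + 1) / β) := by
        rw [lmellin_exp_neg_rpow _ hβ, ← mul_assoc, ← ENNReal.ofReal_mul (by rw [hΓ]; positivity),
          hΓ]
        congr 2
        field_simp

end GenExp

namespace IsSymmetricStable

variable {Ω Ω' : Type*} [MeasurableSpace Ω] [MeasurableSpace Ω'] {μ : Measure Ω} {ν : Measure Ω'}
  [IsProbabilityMeasure μ] [IsProbabilityMeasure ν] {α : ℝ} {S : Ω → ℝ} {S' : Ω' → ℝ} {s : ℝ}

lemma map_eq_map (hS : IsSymmetricStable α S μ) (hS' : IsSymmetricStable α S' ν) :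
    μ.map S = ν.map S' := by
  have := Measure.isProbabilityMeasure_map hS.aemeasurable
  have := Measure.isProbabilityMeasure_map hS'.aemeasurable
  exact Measure.ext_of_charFun (funext fun t => (hS.charFun_eq t).trans (hS'.charFun_eq t).symm)

lemma labsMoment_mul_lGamma_one_sub_half (hα : 0 < α) (hS : IsSymmetricStable α S μ) (s : ℝ) :
    labsMoment S μ s * lGamma (1 - s / 2)
      = ENNReal.ofReal (2 ^ s / √Real.pi) * lGamma ((s + 1) / 2) * lGamma (1 - s / α) := by
  have hsqrt : √(2 * (2 : NNReal)) = 2 := by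
    rw [NNReal.coe_ofNat, Real.sqrt_mul_self zero_le_two]
  rw [hS.labsMoment_mul_lGamma_comm hα two_pos isSymmetricStable_gaussianReal,
    labsMoment_gaussianReal two_ne_zero, hsqrt]

lemma mem_finiteMoments_iff_of_lt_two (hα : 0 < α) (hS : IsSymmetricStable α S μ) (hs : s < 2) :
    s ∈ finiteMoments S μ ↔ -1 < s ∧ s < α := by
  have hfin : lGamma (1 - s / 2) < ∞ := lGamma_lt_top_iff.2 (by linarith)
  have hconst : ENNReal.ofReal (2 ^ s / √Real.pi) ≠ 0 :=
    (ENNReal.ofReal_pos.2 (by positivity)).ne'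
  have h := congrArg (· < ∞) (hS.labsMoment_mul_lGamma_one_sub_half hα s)
  simp only [ENNReal.mul_lt_top_iff, lGamma_ne_zero, hfin, hconst,
    labsMoment_ne_zero hS.aemeasurable (hS.ae_ne_zero hα), ENNReal.ofReal_lt_top, lGamma_lt_top_iff,
    mul_eq_zero, or_self, or_false, and_true, true_and] at h
  rw [mem_finiteMoments_iff, h, sub_pos, div_lt_one hα]
  exact and_congr_left' ⟨fun _ => by linarith, fun _ => by linarith⟩

lemma finiteMoments_of_lt_two (hα : 0 < α) (hα2 : α < 2) (hS : IsSymmetricStable α S μ) :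
    finiteMoments S μ = Set.Ioo (-1) α := by
  ext s
  rcases lt_or_ge s 2 with hs | hs
  · exact hS.mem_finiteMoments_iff_of_lt_two hα hs
  · refine iff_of_false (fun h => ?_) fun h => (h.2.trans hα2).not_ge hs
    have hmem : α ∈ finiteMoments S μ := (ordConnected_finiteMoments hS.aemeasurable).out
      zero_mem_finiteMoments h ⟨hα.le, hα2.le.trans hs⟩
    exact lt_irrefl α ((hS.mem_finiteMoments_iff_of_lt_two hα hα2).1 hmem).2

lemma finiteMoments_two (hS : IsSymmetricStable 2 S μ) : finiteMoments S μ = Set.Ioi (-1) := by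
  ext s
  have hconst : ENNReal.ofReal (√(2 * (2 : NNReal)) ^ s / √Real.pi) ≠ 0 :=
    (ENNReal.ofReal_pos.2 (by positivity)).ne'
  rw [mem_finiteMoments_iff, ← labsMoment_map hS.aemeasurable,
    hS.map_eq_map isSymmetricStable_gaussianReal, Measure.map_id,
    labsMoment_gaussianReal two_ne_zero]
  simp only [ENNReal.mul_lt_top_iff, lGamma_ne_zero, hconst, ENNReal.ofReal_lt_top,
    lGamma_lt_top_iff, or_false, true_and]
  exact ⟨fun _ => by rw [Set.mem_Ioi]; linarith, fun (h : -1 < s) => by linarith⟩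

lemma toReal_labsMoment (hα : 0 < α) (hS : IsSymmetricStable α S μ) (hs : -1 < s) (hsα : s < α)
    (hs2 : s < 2) :
    (labsMoment S μ s).toReal = 2 ^ s * Real.Gamma ((s + 1) / 2) * Real.Gamma (1 - s / α)
      / (√Real.pi * Real.Gamma (1 - s / 2)) := by
  have hΓ2 : 0 < 1 - s / 2 := by linarith
  have hΓα : 0 < 1 - s / α := sub_pos.2 ((div_lt_one hα).2 hsα)
  have hΓ1 : 0 < (s + 1) / 2 := by linarith
  have h := congrArg ENNReal.toReal (hS.labsMoment_mul_lGamma_one_sub_half hα s)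
  simp only [lGamma_of_pos, hΓ1, hΓ2, hΓα, ENNReal.toReal_mul] at h
  rw [ENNReal.toReal_ofReal (Real.Gamma_pos_of_pos hΓ2).le,
    ENNReal.toReal_ofReal (Real.Gamma_pos_of_pos hΓ1).le,
    ENNReal.toReal_ofReal (Real.Gamma_pos_of_pos hΓα).le,
    ENNReal.toReal_ofReal (by positivity)] at h
  rw [eq_div_of_mul_eq (Real.Gamma_pos_of_pos hΓ2).ne' h]
  ring

end IsSymmetricStable

section Continuation

variable {Ω : Type*} [MeasurableSpace Ω] {μ : Measure Ω} {X : Ω → ℝ} {lo hi : ℝ}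

lemma eqOn_strip_of_eq_ofReal {F G : ℂ → ℂ} (hlt : lo < hi)
    (hF : AnalyticOnNhd ℂ F (Complex.re ⁻¹' Set.Ioo lo hi))
    (hG : AnalyticOnNhd ℂ G (Complex.re ⁻¹' Set.Ioo lo hi))
    (h : ∀ x ∈ Set.Ioo lo hi, F (x : ℝ) = G (x : ℝ)) :
    Set.EqOn F G (Complex.re ⁻¹' Set.Ioo lo hi) := by
  obtain ⟨x₀, hx₀⟩ := exists_between hlt
  refine hF.eqOn_of_preconnected_of_frequently_eq hG
    ((convex_Ioo lo hi).linear_preimage Complex.reLm).isPreconnected (z₀ := (x₀ : ℂ)) hx₀ ?_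
  have hmap : Filter.Tendsto (fun x : ℝ => (x : ℂ)) (nhdsWithin x₀ {x₀}ᶜ)
      (nhdsWithin (x₀ : ℂ) {(x₀ : ℂ)}ᶜ) :=
    tendsto_nhdsWithin_of_tendsto_nhds_of_eventually_within _
      (Complex.continuous_ofReal.continuousWithinAt)
      (eventually_mem_nhdsWithin.mono fun x hx => by simpa using hx)
  refine hmap.frequently (Filter.Eventually.frequently ?_)
  filter_upwards [nhdsWithin_le_nhds (Ioo_mem_nhds hx₀.1 hx₀.2)] with x hx using h x hx

lemma abs_cpow_eq_exp_mul_log {x : ℝ} (hx : x ≠ 0) (s : ℂ) :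
    ((|x| : ℝ) : ℂ) ^ s = Complex.exp (s * (Real.log |x| : ℝ)) := by
  rw [Complex.cpow_def_of_ne_zero (by simpa using hx), ← Complex.ofReal_log (abs_nonneg x),
    mul_comm]

lemma absMoment_eq_complexMGF (h0 : ∀ᵐ ω ∂μ, X ω ≠ 0) :
    absMoment X μ = complexMGF (fun ω => Real.log |X ω|) μ :=
  funext fun s => integral_congr_ae (h0.mono fun _ hω => abs_cpow_eq_exp_mul_log hω s)

lemma labsMoment_eq_lintegral_exp (h0 : ∀ᵐ ω ∂μ, X ω ≠ 0) (s : ℝ) :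
    labsMoment X μ s = ∫⁻ ω, ENNReal.ofReal (Real.exp (s * Real.log |X ω|)) ∂μ := by
  refine lintegral_congr_ae (h0.mono fun ω hω => ?_)
  simp only [ENNReal.ofReal_rpow_of_pos (abs_pos.2 hω), Real.rpow_def_of_pos (abs_pos.2 hω),
    mul_comm s]

lemma absMoment_ofReal (hX : AEMeasurable X μ) (h0 : ∀ᵐ ω ∂μ, X ω ≠ 0) (s : ℝ) :
    absMoment X μ s = (labsMoment X μ s).toReal := by
  rw [absMoment_eq_complexMGF h0, complexMGF_ofReal, labsMoment_eq_lintegral_exp h0, mgf,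
    integral_eq_lintegral_of_nonneg_ae (ae_of_all _ fun ω => Real.exp_nonneg _)
      (AEMeasurable.aestronglyMeasurable (by fun_prop))]

lemma finiteMoments_eq_integrableExpSet (hX : AEMeasurable X μ) (h0 : ∀ᵐ ω ∂μ, X ω ≠ 0) :
    finiteMoments X μ = integrableExpSet (fun ω => Real.log |X ω|) μ := by
  ext s
  rw [mem_finiteMoments_iff, labsMoment_eq_lintegral_exp h0, lt_top_iff_ne_top]
  exact lintegral_ofReal_ne_top_iff_integrable (AEMeasurable.aestronglyMeasurable (by fun_prop))
    (ae_of_all _ fun ω => Real.exp_nonneg _)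

lemma hasAbsMoment_of_re_mem_finiteMoments (hX : AEMeasurable X μ) (h0 : ∀ᵐ ω ∂μ, X ω ≠ 0)
    {s : ℂ} (hs : s.re ∈ finiteMoments X μ) : HasAbsMoment X μ s := by
  rw [finiteMoments_eq_integrableExpSet hX h0] at hs
  exact ⟨fun _ => h0, (integrable_cexp_mul_of_re_mem_integrableExpSet (by fun_prop) hs).congr
    (h0.mono fun ω hω => (abs_cpow_eq_exp_mul_log hω s).symm)⟩

lemma analyticOnNhd_absMoment (hX : AEMeasurable X μ) (h0 : ∀ᵐ ω ∂μ, X ω ≠ 0)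
    (hfin : Set.Ioo lo hi ⊆ finiteMoments X μ) :
    AnalyticOnNhd ℂ (absMoment X μ) (Complex.re ⁻¹' Set.Ioo lo hi) := by
  rw [finiteMoments_eq_integrableExpSet hX h0] at hfin
  rw [absMoment_eq_complexMGF h0]
  exact analyticOnNhd_complexMGF.mono
    (Set.preimage_mono (interior_maximal hfin isOpen_Ioo))

end Continuation

namespace GammaQuotient

lemma differentiableAt_prod_Gamma (l : List (ℝ × ℝ)) {s : ℂ}
    (hl : ∀ p ∈ l, ∀ m : ℕ, (p.1 : ℂ) * s + p.2 ≠ -(m : ℂ)) :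
    DifferentiableAt ℂ (fun z => (l.map fun p => Complex.Gamma (p.1 * z + p.2)).prod) s := by
  induction l with
  | nil => simp
  | cons p l ih =>
    simp only [List.map_cons, List.prod_cons]
    have hp := Complex.differentiableAt_Gamma _ (hl p List.mem_cons_self)
    exact (hp.comp s (by fun_prop)).mul (ih fun q hq => hl q (List.mem_cons_of_mem p hq))

lemma differentiableAt_eval (g : GammaQuotient) {s : ℂ}
    (hpole : ∀ p ∈ g.num ++ g.den, ∀ m : ℕ, (p.1 : ℂ) * s + p.2 ≠ -(m : ℂ)) :
    DifferentiableAt ℂ g.eval s := by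
  have hden : (g.den.map fun p => Complex.Gamma (p.1 * s + p.2)).prod ≠ 0 := by
    refine List.prod_ne_zero fun h => ?_
    obtain ⟨p, hp, hzero⟩ := List.mem_map.1 h
    exact Complex.Gamma_ne_zero (hpole p (List.mem_append_right _ hp)) hzero
  have hpow : DifferentiableAt ℂ (fun z => (g.D : ℂ) ^ z) s :=
    differentiableAt_id.const_cpow (.inl (by exact_mod_cast g.D_pos.ne'))
  exact ((hpow.const_mul _).mul (differentiableAt_prod_Gamma g.num fun p hp =>
      hpole p (List.mem_append_left _ hp))).div
    (differentiableAt_prod_Gamma g.den fun p hp => hpole p (List.mem_append_right _ hp)) hden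

end GammaQuotient

lemma hasGammaMoments_of_real {Ω : Type*} [MeasurableSpace Ω] {μ : Measure Ω} {X : Ω → ℝ}
    {g : GammaQuotient} {lo hi : ℝ} (hlt : lo < hi) (hX : AEMeasurable X μ)
    (h0 : ∀ᵐ ω ∂μ, X ω ≠ 0) (hfin : Set.Ioo lo hi ⊆ finiteMoments X μ)
    (hpole : ∀ x ∈ Set.Ioo lo hi, ∀ p ∈ g.num ++ g.den, ∀ m : ℕ, p.1 * x + p.2 ≠ -(m : ℝ))
    (heval : ∀ x ∈ Set.Ioo lo hi, g.eval (x : ℝ) = (labsMoment X μ x).toReal) :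
    HasGammaMoments g X μ lo hi := by
  have hpole' : ∀ s ∈ Complex.re ⁻¹' Set.Ioo lo hi, ∀ p ∈ g.num ++ g.den, ∀ m : ℕ,
      (p.1 : ℂ) * s + p.2 ≠ -(m : ℂ) := fun s hs p hp m h =>
    hpole s.re hs p hp m (by simpa using congrArg Complex.re h)
  have hanalytic : AnalyticOnNhd ℂ g.eval (Complex.re ⁻¹' Set.Ioo lo hi) :=
    DifferentiableOn.analyticOnNhd
      (fun s hs => (g.differentiableAt_eval (hpole' s hs)).differentiableWithinAt)
      (isOpen_Ioo.preimage Complex.continuous_re)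
  have heq := eqOn_strip_of_eq_ofReal hlt (analyticOnNhd_absMoment hX h0 hfin) hanalytic
    fun x hx => (absMoment_ofReal hX h0 x).trans (heval x hx).symm
  exact ⟨hlt, fun s hlo hhi => ⟨hpole' s ⟨hlo, hhi⟩,
    hasAbsMoment_of_re_mem_finiteMoments hX h0 (hfin ⟨hlo, hhi⟩), heq ⟨hlo, hhi⟩⟩⟩

section GenLinnik

variable {Ω : Type*} [MeasurableSpace Ω] {μ : Measure Ω} {α β : ℝ} {S V : Ω → ℝ}

lemma ae_pos_of_hasLaw_genExpMeasure (hV : HasLaw V (genExpMeasure β) μ) : ∀ᵐ ω ∂μ, 0 < V ω :=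
  (hV.ae_iff (p := fun x => 0 < x) (measurableSet_setOfPred.1 measurableSet_Ioi)).2
    ae_pos_genExpMeasure

lemma aemeasurable_genLinnik (hS : IsSymmetricStable α S μ) (hV : HasLaw V (genExpMeasure β) μ) :
    AEMeasurable (genLinnik α β S V) μ :=
  hS.aemeasurable.mul (hV.aemeasurable.pow_const _)

lemma indepFun_rpow_right (hSV : IndepFun S V μ) (c : ℝ) : IndepFun S (fun ω => V ω ^ c) μ :=
  hSV.comp (φ := id) (ψ := fun x => x ^ c) measurable_id (by fun_prop)

lemma labsMoment_genLinnik (hβ : 0 < β) (hS : IsSymmetricStable α S μ)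
    (hV : HasLaw V (genExpMeasure β) μ) (hSV : IndepFun S V μ) (s : ℝ) :
    labsMoment (genLinnik α β S V) μ s = labsMoment S μ s *
      (ENNReal.ofReal (Real.Gamma (1 / β))⁻¹ * lGamma (s / α + 1 / β)) := by
  have hargument : (β / α * s + 1) / β = s / α + 1 / β := by field_simp
  unfold genLinnik
  rw [labsMoment_mul_of_indepFun hS.aemeasurable (hV.aemeasurable.pow_const _)
      (indepFun_rpow_right hSV _), labsMoment_rpow (ae_pos_of_hasLaw_genExpMeasure hV),
    ← labsMoment_map hV.aemeasurable, hV.map_eq, labsMoment_genExpMeasure hβ, hargument]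

lemma finiteMoments_genLinnik (hα : 0 < α) (hβ : 0 < β) (hS : IsSymmetricStable α S μ)
    [IsProbabilityMeasure μ] (hV : HasLaw V (genExpMeasure β) μ) (hSV : IndepFun S V μ) :
    finiteMoments (genLinnik α β S V) μ = finiteMoments S μ ∩ Set.Ioi (-(α / β)) := by
  ext s
  have hconst : ENNReal.ofReal (Real.Gamma (1 / β))⁻¹ ≠ 0 :=
    (ENNReal.ofReal_pos.2 (inv_pos.2 (Real.Gamma_pos_of_pos (by positivity)))).ne'
  have hpos : 0 < s / α + 1 / β ↔ -(α / β) < s := by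
    rw [← neg_lt_iff_pos_add, lt_div_iff₀ hα]
    ring_nf
  simp only [mem_finiteMoments_iff, labsMoment_genLinnik hβ hS hV hSV, Set.mem_inter_iff,
    Set.mem_Ioi, ENNReal.mul_lt_top_iff, ENNReal.ofReal_lt_top, lGamma_lt_top_iff, hpos, hconst,
    labsMoment_ne_zero hS.aemeasurable (hS.ae_ne_zero hα), lGamma_ne_zero, mul_eq_zero, true_and,
    or_false]

variable [IsProbabilityMeasure μ]

lemma finiteMoments_genLinnik_of_lt_two (hα : 0 < α) (hα2 : α < 2) (hβ : 0 < β)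
    (hS : IsSymmetricStable α S μ) (hV : HasLaw V (genExpMeasure β) μ) (hSV : IndepFun S V μ) :
    finiteMoments (genLinnik α β S V) μ = Set.Ioo (-(min (α / β) 1)) α := by
  rw [finiteMoments_genLinnik hα hβ hS hV hSV, hS.finiteMoments_of_lt_two hα hα2,
    Set.Ioo_inter_Ioi, max_neg_neg, min_comm]

lemma finiteMoments_genLinnik_two (hβ : 0 < β) (hS : IsSymmetricStable 2 S μ)
    (hV : HasLaw V (genExpMeasure β) μ) (hSV : IndepFun S V μ) :
    finiteMoments (genLinnik 2 β S V) μ = Set.Ioi (-(min (2 / β) 1)) := by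
  rw [finiteMoments_genLinnik two_pos hβ hS hV hSV, hS.finiteMoments_two, Set.Ioi_inter_Ioi,
    max_neg_neg, min_comm]

lemma neg_min_div_one_lt (hα : 0 < α) (hβ : 0 < β) : -(min (α / β) 1) < α := by
  have : 0 < min (α / β) 1 := lt_min (by positivity) one_pos
  linarith

lemma Ioo_subset_finiteMoments_genLinnik (hα : 0 < α) (hα2 : α ≤ 2) (hβ : 0 < β)
    (hS : IsSymmetricStable α S μ) (hV : HasLaw V (genExpMeasure β) μ) (hSV : IndepFun S V μ) :
    Set.Ioo (-(min (α / β) 1)) α ⊆ finiteMoments (genLinnik α β S V) μ := by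
  rcases hα2.eq_or_lt with rfl | hα2
  · exact (finiteMoments_genLinnik_two hβ hS hV hSV).symm ▸ Set.Ioo_subset_Ioi_self
  · exact (finiteMoments_genLinnik_of_lt_two hα hα2 hβ hS hV hSV).ge

lemma rhoPlus_genLinnik (hα : 0 < α) (hα2 : α ≤ 2) (hβ : 0 < β)
    (hS : IsSymmetricStable α S μ) (hV : HasLaw V (genExpMeasure β) μ) (hSV : IndepFun S V μ) :
    rhoPlus (genLinnik α β S V) μ = if α = 2 then (⊤ : EReal) else ((α : ℝ) : EReal) := by
  split_ifs with h
  · subst h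
    exact rhoPlus_of_finiteMoments_eq_Ioi (finiteMoments_genLinnik_two hβ hS hV hSV)
  · exact rhoPlus_of_finiteMoments_eq_Ioo (neg_min_div_one_lt hα hβ)
      (finiteMoments_genLinnik_of_lt_two hα (hα2.lt_of_ne h) hβ hS hV hSV)

lemma rhoMinus_genLinnik (hα : 0 < α) (hα2 : α ≤ 2) (hβ : 0 < β)
    (hS : IsSymmetricStable α S μ) (hV : HasLaw V (genExpMeasure β) μ) (hSV : IndepFun S V μ) :
    rhoMinus (genLinnik α β S V) μ = ((-(min (α / β) 1) : ℝ) : EReal) := by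
  rcases hα2.eq_or_lt with rfl | hα2
  · exact rhoMinus_of_finiteMoments_eq_Ioi (finiteMoments_genLinnik_two hβ hS hV hSV)
  · exact rhoMinus_of_finiteMoments_eq_Ioo (neg_min_div_one_lt hα hβ)
      (finiteMoments_genLinnik_of_lt_two hα hα2 hβ hS hV hSV)

lemma charFun_genLinnik (hα : 0 < α) (hβ : 0 < β) (hS : IsSymmetricStable α S μ)
    (hV : HasLaw V (genExpMeasure β) μ) (hSV : IndepFun S V μ) (t : ℝ) :
    charFun (μ.map (genLinnik α β S V)) t = ((1 / (1 + |t| ^ α) ^ (1 / β) : ℝ) : ℂ) := by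
  have hcond : ∀ᵐ ω ∂μ, charFun (μ.map S) (t * V ω ^ (β / α))
      = (Real.exp (-(|t| ^ α * V ω ^ β)) : ℝ) := by
    filter_upwards [ae_pos_of_hasLaw_genExpMeasure hV] with ω hω
    rw [hS.charFun_eq, abs_mul, Real.mul_rpow (abs_nonneg _) (abs_nonneg _),
      abs_of_pos (Real.rpow_pos_of_pos hω _), ← Real.rpow_mul hω.le, div_mul_cancel₀ _ hα.ne']
  calc charFun (μ.map (genLinnik α β S V)) t
      = ∫ ω, charFun (μ.map S) (t * V ω ^ (β / α)) ∂μ :=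
        charFun_mul_of_indepFun hS.aemeasurable (hV.aemeasurable.pow_const _)
          (indepFun_rpow_right hSV _) t
    _ = ((∫ ω, Real.exp (-(|t| ^ α * V ω ^ β)) ∂μ : ℝ) : ℂ) := by
        rw [integral_congr_ae hcond, integral_complex_ofReal]
    _ = ((∫ x, Real.exp (-(|t| ^ α * x ^ β)) ∂(genExpMeasure β) : ℝ) : ℂ) := by
        rw [← hV.integral_comp (f := fun x => Real.exp (-(|t| ^ α * x ^ β)))
          (Measurable.aestronglyMeasurable (by fun_prop))]
        rfl
    _ = ((1 / (1 + |t| ^ α) ^ (1 / β) : ℝ) : ℂ) := by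
        rw [integral_exp_neg_mul_rpow_genExpMeasure hβ
          (neg_one_lt_zero.trans_le (Real.rpow_nonneg (abs_nonneg t) α))]

end GenLinnik

section GenLinnikQuotient

variable {α β : ℝ}

/-- The Gamma quotient of `genLinnik α β`. The condition `α ≠ 0` ensures that the coefficients
`± 1 / α` of `s` are nonzero. -/
noncomputable def genLinnikQuotient (α β : ℝ) (hα : α ≠ 0) : GammaQuotient where
  C := (√Real.pi * Real.Gamma (1 / β))⁻¹
  D := 2
  num := [(1 / 2, 1 / 2), (-1 / α, 1), (1 / α, 1 / β)]
  den := [(-1 / 2, 1)]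
  D_pos := two_pos
  num_ne := by simp [hα]
  den_ne := by simp

lemma eval_genLinnikQuotient (hα : α ≠ 0) (s : ℂ) :
    (genLinnikQuotient α β hα).eval s =
      (2 : ℂ) ^ s * (Complex.Gamma ((s + 1) / 2) * Complex.Gamma (1 - s / α)
          * Complex.Gamma (s / α + 1 / β))
        / ((Real.sqrt Real.pi : ℂ) * Complex.Gamma (1 / β) * Complex.Gamma (1 - s / 2)) := by
  simp only [GammaQuotient.eval, genLinnikQuotient, List.map_cons, List.map_nil, List.prod_cons,
    List.prod_nil, mul_one]
  push_cast
  rw [← Complex.Gamma_ofReal]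
  push_cast
  ring_nf

lemma genLinnikQuotient_arg_pos (hα : 0 < α) (hα2 : α ≤ 2) {x : ℝ}
    (hx : x ∈ Set.Ioo (-(min (α / β) 1)) α) :
    ∀ p ∈ (genLinnikQuotient α β hα.ne').num ++ (genLinnikQuotient α β hα.ne').den,
      0 < p.1 * x + p.2 := by
  obtain ⟨hlo, hhi⟩ := hx
  have hone : -1 < x := (neg_le_neg (min_le_right _ _)).trans_lt hlo
  have hdiv : -(α / β) < x := (neg_le_neg (min_le_left _ _)).trans_lt hlo
  have hleft : -(1 / β) < x / α := by
    rw [lt_div_iff₀ hα, neg_mul, one_div_mul_eq_div]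
    exact hdiv
  have hright : x / α < 1 := (div_lt_one hα).2 hhi
  simp only [genLinnikQuotient, List.cons_append, List.nil_append, List.forall_mem_cons,
    List.not_mem_nil, false_imp_iff, implies_true, and_true, neg_div, neg_mul, one_div_mul_eq_div]
  exact ⟨by linarith, by linarith, by linarith, by linarith⟩

lemma gam_genLinnikQuotient (hα : 0 < α) : (genLinnikQuotient α β hα.ne').gam = 2 / α := by
  simp only [GammaQuotient.gam, genLinnikQuotient, List.map_cons, List.map_nil, List.sum_cons,
    List.sum_nil, neg_div, abs_neg, abs_of_pos (one_div_pos.2 hα),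
    abs_of_pos (one_half_pos (α := ℝ))]
  ring

lemma gam'_genLinnikQuotient (hα : α ≠ 0) : (genLinnikQuotient α β hα).gam' = 1 := by
  simp only [GammaQuotient.gam', genLinnikQuotient, List.map_cons, List.map_nil, List.sum_cons,
    List.sum_nil]
  ring

lemma del_genLinnikQuotient (hα : α ≠ 0) : (genLinnikQuotient α β hα).del = 1 / β - 1 / 2 := by
  simp only [GammaQuotient.del, genLinnikQuotient, List.map_cons, List.map_nil, List.sum_cons,
    List.sum_nil, List.length_cons, List.length_nil]
  push_cast
  ring

lemma kap_genLinnikQuotient (hα : α ≠ 0) : (genLinnikQuotient α β hα).kap = 0 := by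
  simp only [GammaQuotient.kap, genLinnikQuotient, List.map_cons, List.map_nil, List.sum_cons,
    List.sum_nil, neg_div, Real.log_neg_eq_log, Real.log_abs, one_div, Real.log_inv]
  ring

lemma C₁_genLinnikQuotient (hα : 0 < α) (hβ : 0 < β) :
    (genLinnikQuotient α β hα.ne').C₁
      = 2 * √(2 * Real.pi) / (Real.Gamma (1 / β) * α ^ (1 / β)) := by
  have : 0 < Real.Gamma (1 / β) := Real.Gamma_pos_of_pos (by positivity)
  have hhalf : (1 - 1 / 2 : ℝ) = 1 / 2 := by norm_num
  have hlength : ((3 : ℕ) - (1 : ℕ) : ℝ) / 2 = 1 := by norm_num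
  have hpow : (1 / α) ^ (1 / 2 : ℝ) * (1 / α) ^ (1 / β - 1 / 2) = 1 / α ^ (1 / β) := by
    rw [← Real.rpow_add (by positivity), add_sub_cancel, Real.div_rpow zero_le_one hα.le,
      Real.one_rpow]
  simp only [GammaQuotient.C₁, genLinnikQuotient, List.map_cons, List.map_nil, List.prod_cons,
    List.prod_nil, List.length_cons, List.length_nil, neg_div, abs_neg,
    abs_of_pos (one_div_pos.2 hα), abs_of_pos (one_half_pos (α := ℝ)), sub_self, Real.rpow_zero,
    mul_one, one_mul, zero_add, Nat.reduceAdd, hhalf, hlength, hpow, Real.rpow_one]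
  rw [abs_of_pos (by positivity), ← Real.sqrt_eq_rpow, Real.sqrt_mul zero_le_two,
    Real.sqrt_div zero_le_one, Real.sqrt_one]
  field_simp
  rw [Real.sq_sqrt Real.pi_pos.le]

end GenLinnikQuotient

section GenLinnikMoments

variable {Ω : Type*} [MeasurableSpace Ω] {μ : Measure Ω} [IsProbabilityMeasure μ] {α β : ℝ}
  {S V : Ω → ℝ}

lemma eval_genLinnikQuotient_ofReal (hα : 0 < α) (hα2 : α ≤ 2) (hβ : 0 < β)
    (hS : IsSymmetricStable α S μ) (hV : HasLaw V (genExpMeasure β) μ) (hSV : IndepFun S V μ)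
    {x : ℝ} (hx : x ∈ Set.Ioo (-(min (α / β) 1)) α) :
    (genLinnikQuotient α β hα.ne').eval x = (labsMoment (genLinnik α β S V) μ x).toReal := by
  have hone : -1 < x := (neg_le_neg (min_le_right _ _)).trans_lt hx.1
  have harg : 0 < x / α + 1 / β := by
    simpa [genLinnikQuotient, div_eq_inv_mul] using
      genLinnikQuotient_arg_pos hα hα2 hx (1 / α, 1 / β) (by simp [genLinnikQuotient])
  rw [eval_genLinnikQuotient, labsMoment_genLinnik hβ hS hV hSV, ENNReal.toReal_mul,
    hS.toReal_labsMoment hα hone hx.2 (hx.2.trans_le hα2), ENNReal.toReal_mul,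
    lGamma_of_pos harg, ENNReal.toReal_ofReal (Real.Gamma_pos_of_pos harg).le,
    ENNReal.toReal_ofReal (inv_pos.2 (Real.Gamma_pos_of_pos (by positivity))).le]
  push_cast [Complex.ofReal_cpow zero_le_two, ← Complex.Gamma_ofReal]
  ring

lemma hasGammaMoments_genLinnik (hα : 0 < α) (hα2 : α ≤ 2) (hβ : 0 < β)
    (hS : IsSymmetricStable α S μ) (hV : HasLaw V (genExpMeasure β) μ) (hSV : IndepFun S V μ) :
    HasGammaMoments (genLinnikQuotient α β hα.ne') (genLinnik α β S V) μ
      (-(min (α / β) 1)) α := by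
  have hne : ∀ᵐ ω ∂μ, genLinnik α β S V ω ≠ 0 := by
    filter_upwards [hS.ae_ne_zero hα, ae_pos_of_hasLaw_genExpMeasure hV] with ω hSω hVω
    exact mul_ne_zero hSω (Real.rpow_pos_of_pos hVω _).ne'
  refine hasGammaMoments_of_real (neg_min_div_one_lt hα hβ) (aemeasurable_genLinnik hS hV) hne
    (Ioo_subset_finiteMoments_genLinnik hα hα2 hβ hS hV hSV) (fun x hx p hp m => ?_)
    fun x hx => eval_genLinnikQuotient_ofReal hα hα2 hβ hS hV hSV hx
  exact ((neg_nonpos.2 m.cast_nonneg).trans_lt (genLinnikQuotient_arg_pos hα hα2 hx p hp)).ne'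

lemma absMoment_genLinnik (hα : 0 < α) (hα2 : α ≤ 2) (hβ : 0 < β)
    (hS : IsSymmetricStable α S μ) (hV : HasLaw V (genExpMeasure β) μ) (hSV : IndepFun S V μ)
    {s : ℂ} (hlo : -(min (α / β) 1) < s.re) (hhi : s.re < α) :
    HasAbsMoment (genLinnik α β S V) μ s ∧
      absMoment (genLinnik α β S V) μ s =
        (2 : ℂ) ^ s * (Complex.Gamma ((s + 1) / 2) * Complex.Gamma (1 - s / α)
            * Complex.Gamma (s / α + 1 / β))
          / ((Real.sqrt Real.pi : ℂ) * Complex.Gamma (1 / β) * Complex.Gamma (1 - s / 2)) := by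
  rw [← eval_genLinnikQuotient hα.ne']
  exact ((hasGammaMoments_genLinnik hα hα2 hβ hS hV hSV).2 s hlo hhi).2

end GenLinnikMoments

section Lamperti

lemma lintegral_rpow_sub_one_mul_exp_neg_mul_rpow {a b : ℝ} (ha : 0 < a) (hb : 0 < b) :
    ∫⁻ w in Set.Ioi 0, ENNReal.ofReal (a * w ^ (a - 1) * Real.exp (-(b * w ^ a)))
      = ENNReal.ofReal b⁻¹ := by
  have hmellin : lmellin (fun w => ENNReal.ofReal (Real.exp (-(b * w ^ a)))) a
      = ENNReal.ofReal a⁻¹ * ENNReal.ofReal b⁻¹ := by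
    refine (lmellin_comp_rpow (fun t => ENNReal.ofReal (Real.exp (-(b * t)))) a ha).trans ?_
    rw [lmellin_comp_mul_left (fun t => ENNReal.ofReal (Real.exp (-t))) _ hb, div_self ha.ne',
      Real.rpow_neg_one, ← lGamma, lGamma_of_pos one_pos, Real.Gamma_one, ENNReal.ofReal_one,
      mul_one]
  calc ∫⁻ w in Set.Ioi 0, ENNReal.ofReal (a * w ^ (a - 1) * Real.exp (-(b * w ^ a)))
      = ENNReal.ofReal a * lmellin (fun w => ENNReal.ofReal (Real.exp (-(b * w ^ a)))) a := by
        unfold lmellin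
        rw [← lintegral_const_mul' _ _ ENNReal.ofReal_ne_top]
        refine setLIntegral_congr_fun measurableSet_Ioi fun w (hw : 0 < w) => ?_
        simp only
        rw [← ENNReal.ofReal_mul (by positivity), ← ENNReal.ofReal_mul ha.le, mul_assoc]
    _ = ENNReal.ofReal b⁻¹ := by
        rw [hmellin, ← mul_assoc, ← ENNReal.ofReal_mul ha.le, mul_inv_cancel₀ ha.ne',
          ENNReal.ofReal_one, one_mul]

lemma lintegral_exp_neg_mul_mul_mul_exp_neg_mul {x y : ℝ} (hx : 0 < x) (hy : 0 < y) :
    ∫⁻ w in Set.Ioi 0, ENNReal.ofReal (Real.exp (-(w * x)))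
        * ENNReal.ofReal (y * Real.exp (-(w * y)))
      = ENNReal.ofReal (1 / (1 + x / y)) := by
  have hquotient : 1 / (1 + x / y) = y * (x + y)⁻¹ := by field_simp; ring
  rw [hquotient, ENNReal.ofReal_mul hy.le,
    ← lintegral_rpow_sub_one_mul_exp_neg_mul_rpow one_pos (by positivity),
    ← lintegral_const_mul' _ _ ENNReal.ofReal_ne_top]
  refine setLIntegral_congr_fun measurableSet_Ioi fun w _ => ?_
  simp only [sub_self, Real.rpow_zero, Real.rpow_one, one_mul]
  rw [← ENNReal.ofReal_mul (Real.exp_nonneg _), ← ENNReal.ofReal_mul hy.le, mul_left_comm,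
    ← Real.exp_add]
  ring_nf

variable {Ω : Type*} [MeasurableSpace Ω] {μ : Measure Ω} {X Y T T' : Ω → ℝ} {a : ℝ}

lemma lintegral_one_div_one_add_div_of_indepFun [SFinite μ] (hX : AEMeasurable X μ)
    (hY : AEMeasurable Y μ) (hXpos : ∀ᵐ ω ∂μ, 0 < X ω) (hYpos : ∀ᵐ ω ∂μ, 0 < Y ω)
    (h : IndepFun X Y μ) :
    ∫⁻ ω, ENNReal.ofReal (1 / (1 + X ω / Y ω)) ∂μ
      = ∫⁻ w in Set.Ioi 0, (∫⁻ ω, ENNReal.ofReal (Real.exp (-(w * X ω))) ∂μ)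
          * ∫⁻ ω, ENNReal.ofReal (Y ω * Real.exp (-(w * Y ω))) ∂μ := by
  have hmeas : AEMeasurable (Function.uncurry fun ω (w : ℝ) =>
      ENNReal.ofReal (Real.exp (-(w * X ω))) * ENNReal.ofReal (Y ω * Real.exp (-(w * Y ω))))
      (μ.prod (volume.restrict (Set.Ioi 0))) := by
    have : AEMeasurable (fun p : Ω × ℝ => X p.1) (μ.prod (volume.restrict (Set.Ioi 0))) :=
      hX.comp_fst
    have : AEMeasurable (fun p : Ω × ℝ => Y p.1) (μ.prod (volume.restrict (Set.Ioi 0))) :=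
      hY.comp_fst
    simp only [Function.uncurry_def]
    fun_prop
  calc ∫⁻ ω, ENNReal.ofReal (1 / (1 + X ω / Y ω)) ∂μ
      = ∫⁻ ω, (∫⁻ w in Set.Ioi 0, ENNReal.ofReal (Real.exp (-(w * X ω)))
          * ENNReal.ofReal (Y ω * Real.exp (-(w * Y ω)))) ∂μ := by
        refine lintegral_congr_ae ?_
        filter_upwards [hXpos, hYpos] with ω hXω hYω
        exact (lintegral_exp_neg_mul_mul_mul_exp_neg_mul hXω hYω).symm
    _ = ∫⁻ w in Set.Ioi 0, ∫⁻ ω, ENNReal.ofReal (Real.exp (-(w * X ω)))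
          * ENNReal.ofReal (Y ω * Real.exp (-(w * Y ω))) ∂μ := lintegral_lintegral_swap hmeas
    _ = ∫⁻ w in Set.Ioi 0, (∫⁻ ω, ENNReal.ofReal (Real.exp (-(w * X ω))) ∂μ)
          * ∫⁻ ω, ENNReal.ofReal (Y ω * Real.exp (-(w * Y ω))) ∂μ :=
        lintegral_congr fun w =>
          lintegral_mul_eq_lintegral_mul_lintegral_of_indepFun'' (by fun_prop) (by fun_prop)
            (h.comp (φ := fun x => ENNReal.ofReal (Real.exp (-(w * x))))
              (ψ := fun y => ENNReal.ofReal (y * Real.exp (-(w * y)))) (by fun_prop)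
              (by fun_prop))

namespace IsPositiveStable

variable [IsProbabilityMeasure μ]

lemma lintegral_exp_neg_mul (hT : IsPositiveStable a T μ) {w : ℝ} (hw : 0 < w) :
    ∫⁻ ω, ENNReal.ofReal (Real.exp (-(w * T ω))) ∂μ = ENNReal.ofReal (Real.exp (-w ^ a)) := by
  rw [← hT.laplace_eq w hw, ofReal_integral_eq_lintegral_ofReal
    (integrable_exp_neg_mul hT.aemeasurable (hT.pos.mono fun _ => le_of_lt) hw.le)
    (ae_of_all _ fun ω => Real.exp_nonneg _)]

lemma integral_mul_exp_neg_mul (hT : IsPositiveStable a T μ) {w : ℝ} (hw : 0 < w) :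
    ∫ ω, T ω * Real.exp (-(w * T ω)) ∂μ = a * w ^ (a - 1) * Real.exp (-w ^ a) := by
  have hderiv : HasDerivAt (fun w => ∫ ω, Real.exp (-(w * T ω)) ∂μ)
      (Real.exp (-w ^ a) * -(a * w ^ (a - 1))) w := by
    refine (Real.hasDerivAt_rpow_const (.inl hw.ne')).neg.exp.congr_of_eventuallyEq ?_
    filter_upwards [lt_mem_nhds hw] with v hv using hT.laplace_eq v hv
  have huniq := (hasDerivAt_integral_exp_neg_mul hT.aemeasurable
    (hT.pos.mono fun _ => le_of_lt) hw).unique hderiv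
  linarith

lemma lintegral_mul_exp_neg_mul (hT : IsPositiveStable a T μ) {w : ℝ} (hw : 0 < w) :
    ∫⁻ ω, ENNReal.ofReal (T ω * Real.exp (-(w * T ω))) ∂μ
      = ENNReal.ofReal (a * w ^ (a - 1) * Real.exp (-w ^ a)) := by
  rw [← hT.integral_mul_exp_neg_mul hw, ofReal_integral_eq_lintegral_ofReal
    (integrable_mul_exp_neg_mul hT.aemeasurable (hT.pos.mono fun _ => le_of_lt) hw)
    (hT.pos.mono fun ω hω => mul_nonneg hω.le (Real.exp_nonneg _))]

end IsPositiveStable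

lemma lamperti_pos (hT : IsPositiveStable a T μ) (hT' : IsPositiveStable a T' μ) :
    ∀ᵐ ω ∂μ, 0 < lamperti T T' ω :=
  hT.pos.mp (hT'.pos.mono fun _ hω' hω => div_pos hω hω')

lemma aemeasurable_lamperti (hT : AEMeasurable T μ) (hT' : AEMeasurable T' μ) :
    AEMeasurable (lamperti T T') μ :=
  hT.div hT'

variable [IsProbabilityMeasure μ]

lemma lintegral_one_div_one_add_mul_lamperti (ha : 0 < a) (hT : IsPositiveStable a T μ)
    (hT' : IsPositiveStable a T' μ) (h : IndepFun T T' μ) {c : ℝ} (hc : 0 < c) :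
    ∫⁻ ω, ENNReal.ofReal (1 / (1 + c * lamperti T T' ω)) ∂μ
      = ENNReal.ofReal (1 / (1 + c ^ a)) := by
  have hproduct : ∀ w ∈ Set.Ioi (0 : ℝ),
      (∫⁻ ω, ENNReal.ofReal (Real.exp (-(w * (c * T ω)))) ∂μ)
        * ∫⁻ ω, ENNReal.ofReal (T' ω * Real.exp (-(w * T' ω))) ∂μ
      = ENNReal.ofReal (a * w ^ (a - 1) * Real.exp (-((1 + c ^ a) * w ^ a))) := by
    intro w (hw : 0 < w)
    simp only [← mul_assoc w c]
    rw [hT.lintegral_exp_neg_mul (mul_pos hw hc), hT'.lintegral_mul_exp_neg_mul hw,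
      ← ENNReal.ofReal_mul (Real.exp_nonneg _), Real.mul_rpow hw.le hc.le, mul_left_comm,
      ← Real.exp_add]
    ring_nf
  simp only [lamperti, ← mul_div_assoc]
  rw [lintegral_one_div_one_add_div_of_indepFun (hT.aemeasurable.const_mul c) hT'.aemeasurable
      (hT.pos.mono fun _ => mul_pos hc) hT'.pos
      (h.comp (φ := fun x => c * x) (by fun_prop) measurable_id),
    setLIntegral_congr_fun measurableSet_Ioi hproduct,
    lintegral_rpow_sub_one_mul_exp_neg_mul_rpow ha (by positivity), one_div]

lemma integral_one_div_one_add_mul_lamperti (ha : 0 < a) (hT : IsPositiveStable a T μ)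
    (hT' : IsPositiveStable a T' μ) (h : IndepFun T T' μ) {c : ℝ} (hc : 0 < c) :
    ∫ ω, 1 / (1 + c * lamperti T T' ω) ∂μ = 1 / (1 + c ^ a) := by
  have hmeas := aemeasurable_lamperti hT.aemeasurable hT'.aemeasurable
  rw [integral_eq_lintegral_of_nonneg_ae
      ((lamperti_pos hT hT').mono fun ω hω => by
        simp only [Pi.zero_apply]
        positivity)
      (AEMeasurable.aestronglyMeasurable (by fun_prop)),
    lintegral_one_div_one_add_mul_lamperti ha hT hT' h hc,
    ENNReal.toReal_ofReal (by positivity)]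

end Lamperti

section Linnik

lemma linnik_eq_genLinnik {Ω : Type*} (α : ℝ) (S V : Ω → ℝ) :
    linnik α S V = genLinnik α 1 S V :=
  rfl

variable {Ω Ω' : Type*} [MeasurableSpace Ω] [MeasurableSpace Ω'] {μ : Measure Ω} {ν : Measure Ω'}
  {α β : ℝ} {S V : Ω → ℝ} {S' V' T T' : Ω' → ℝ}

lemma aemeasurable_linnik (hS : IsSymmetricStable α S μ) (hV : HasLaw V (expMeasure 1) μ) :
    AEMeasurable (linnik α S V) μ :=
  aemeasurable_genLinnik (β := 1) hS (expMeasure_one_eq_genExpMeasure ▸ hV)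

variable [IsProbabilityMeasure μ] [IsProbabilityMeasure ν]

lemma charFun_linnik (hα : 0 < α) (hS : IsSymmetricStable α S μ)
    (hV : HasLaw V (expMeasure 1) μ) (hSV : IndepFun S V μ) (t : ℝ) :
    charFun (μ.map (linnik α S V)) t = ((1 / (1 + |t| ^ α) : ℝ) : ℂ) := by
  rw [linnik_eq_genLinnik, charFun_genLinnik hα one_pos hS (expMeasure_one_eq_genExpMeasure ▸ hV)
    hSV, div_one, Real.rpow_one]

lemma absMoment_linnik (hα : 0 < α) (hα2 : α ≤ 2) (hS : IsSymmetricStable α S μ)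
    (hV : HasLaw V (expMeasure 1) μ) (hSV : IndepFun S V μ) {s : ℂ} (hlo : -(min α 1) < s.re)
    (hhi : s.re < α) :
    HasAbsMoment (linnik α S V) μ s ∧
      absMoment (linnik α S V) μ s =
        (2 : ℂ) ^ s * (Complex.Gamma ((1 + s) / 2) * Complex.Gamma (1 + s / α)
            * Complex.Gamma (1 - s / α))
          / ((Real.sqrt Real.pi : ℂ) * Complex.Gamma (1 - s / 2)) := by
  have h := absMoment_genLinnik hα hα2 one_pos hS (expMeasure_one_eq_genExpMeasure ▸ hV) hSV
    (by rwa [div_one]) hhi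
  simp only [Complex.ofReal_one, div_one, Complex.Gamma_one, mul_one, ← linnik_eq_genLinnik] at h
  rwa [add_comm 1 s, add_comm 1 (s / (α : ℂ)), mul_right_comm (Complex.Gamma _)]

lemma charFun_linnik_mul_lamperti (hα : 0 < α) (hβ : 0 < β) (hS' : IsSymmetricStable β S' ν)
    (hV' : HasLaw V' (expMeasure 1) ν) (hSV' : IndepFun S' V' ν)
    (hT : IsPositiveStable (α / β) T ν) (hT' : IsPositiveStable (α / β) T' ν)
    (hTT' : IndepFun T T' ν)
    (hind : IndepFun (linnik β S' V') (fun ω => lamperti T T' ω ^ (1 / β)) ν) (t : ℝ) :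
    charFun (ν.map fun ω => linnik β S' V' ω * lamperti T T' ω ^ (1 / β)) t
      = ((1 / (1 + |t| ^ α) : ℝ) : ℂ) := by
  rw [charFun_mul_of_indepFun (aemeasurable_linnik hS' hV')
    ((aemeasurable_lamperti hT.aemeasurable hT'.aemeasurable).pow_const _) hind]
  simp_rw [charFun_linnik hβ hS' hV' hSV']
  rw [integral_complex_ofReal]
  congr 1
  have habs : ∀ᵐ ω ∂ν, 1 / (1 + |t * lamperti T T' ω ^ (1 / β)| ^ β)
      = 1 / (1 + |t| ^ β * lamperti T T' ω) := by
    filter_upwards [lamperti_pos hT hT'] with ω hω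
    rw [abs_mul, Real.mul_rpow (abs_nonneg _) (abs_nonneg _),
      abs_of_pos (Real.rpow_pos_of_pos hω _), ← Real.rpow_mul hω.le, one_div_mul_cancel hβ.ne',
      Real.rpow_one]
  rw [integral_congr_ae habs]
  rcases eq_or_ne t 0 with rfl | ht
  · simp [Real.zero_rpow hα.ne', Real.zero_rpow hβ.ne']
  · rw [integral_one_div_one_add_mul_lamperti (div_pos hα hβ) hT hT' hTT'
      (Real.rpow_pos_of_pos (abs_pos.2 ht) β), ← Real.rpow_mul (abs_nonneg t),
      mul_div_cancel₀ _ hβ.ne']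

lemma identDistrib_linnik_mul_lamperti (hα : 0 < α) (hβ : 0 < β)
    (hS : IsSymmetricStable α S μ) (hV : HasLaw V (expMeasure 1) μ) (hSV : IndepFun S V μ)
    (hS' : IsSymmetricStable β S' ν) (hV' : HasLaw V' (expMeasure 1) ν)
    (hSV' : IndepFun S' V' ν) (hT : IsPositiveStable (α / β) T ν)
    (hT' : IsPositiveStable (α / β) T' ν) (hTT' : IndepFun T T' ν)
    (hind : IndepFun (linnik β S' V') (fun ω => lamperti T T' ω ^ (1 / β)) ν) :
    IdentDistrib (linnik α S V)
      (fun ω => linnik β S' V' ω * lamperti T T' ω ^ (1 / β)) μ ν := by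
  have hX := aemeasurable_linnik hS hV
  have hY := (aemeasurable_linnik hS' hV').mul
    ((aemeasurable_lamperti hT.aemeasurable hT'.aemeasurable).pow_const (1 / β))
  have := Measure.isProbabilityMeasure_map hX
  have := Measure.isProbabilityMeasure_map hY
  refine ⟨hX, hY, Measure.ext_of_charFun (funext fun t => ?_)⟩
  exact (charFun_linnik hα hS hV hSV t).trans
    (charFun_linnik_mul_lamperti hα hβ hS' hV' hSV' hT hT' hTT' hind t).symm

end Linnik

end LinnikDistribution

open LinnikDistribution

theorem mainTheorem8 :
    -- the Linnik variable `X_α = S_α V_1^{1/α}`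
    (∀ (Ω : Type*) [MeasurableSpace Ω] (μ : Measure Ω) [IsProbabilityMeasure μ]
        (α : ℝ) (S V : Ω → ℝ),
      0 < α → α ≤ 2 →
      LinnikDistribution.IsSymmetricStable α S μ → HasLaw V (expMeasure 1) μ → IndepFun S V μ →
      (∀ t : ℝ, charFun (μ.map (LinnikDistribution.linnik α S V)) t
          = ((1 / (1 + |t| ^ α) : ℝ) : ℂ)) ∧
      (∀ s : ℂ, -(min α 1) < s.re → s.re < α →
        LinnikDistribution.HasAbsMoment (LinnikDistribution.linnik α S V) μ s ∧
        LinnikDistribution.absMoment (LinnikDistribution.linnik α S V) μ s =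
          (2 : ℂ) ^ s * (Complex.Gamma ((1 + s) / 2) * Complex.Gamma (1 + s / α)
              * Complex.Gamma (1 - s / α))
            / ((Real.sqrt Real.pi : ℂ) * Complex.Gamma (1 - s / 2))) ∧
      LinnikDistribution.rhoPlus (LinnikDistribution.linnik α S V) μ
        = (if α = 2 then (⊤ : EReal) else ((α : ℝ) : EReal)) ∧
      LinnikDistribution.rhoMinus (LinnikDistribution.linnik α S V) μ
        = ((-(min α 1) : ℝ) : EReal) ∧
      (∃ g : LinnikDistribution.GammaQuotient,
        LinnikDistribution.HasGammaMoments g (LinnikDistribution.linnik α S V) μ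
          (-(min α 1)) α ∧
        g.gam = 2 / α ∧ g.gam' = 1 ∧ g.del = 1 / 2 ∧ g.kap = 0 ∧
        g.C₁ = 2 * Real.sqrt (2 * Real.pi) / α)) ∧
    -- the generalized Linnik variable `X_{α,β} = S_α V_β^{β/α}`
    (∀ (Ω : Type*) [MeasurableSpace Ω] (μ : Measure Ω) [IsProbabilityMeasure μ]
        (α β : ℝ) (S V : Ω → ℝ),
      0 < α → α ≤ 2 → 0 < β →
      LinnikDistribution.IsSymmetricStable α S μ →
      HasLaw V (LinnikDistribution.genExpMeasure β) μ → IndepFun S V μ →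
      (∀ t : ℝ, charFun (μ.map (LinnikDistribution.genLinnik α β S V)) t
          = ((1 / (1 + |t| ^ α) ^ (1 / β) : ℝ) : ℂ)) ∧
      (∀ s : ℂ, -(min (α / β) 1) < s.re → s.re < α →
        LinnikDistribution.HasAbsMoment (LinnikDistribution.genLinnik α β S V) μ s ∧
        LinnikDistribution.absMoment (LinnikDistribution.genLinnik α β S V) μ s =
          (2 : ℂ) ^ s * (Complex.Gamma ((s + 1) / 2) * Complex.Gamma (1 - s / α)
              * Complex.Gamma (s / α + 1 / β))
            / ((Real.sqrt Real.pi : ℂ) * Complex.Gamma (1 / β) * Complex.Gamma (1 - s / 2))) ∧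
      LinnikDistribution.rhoPlus (LinnikDistribution.genLinnik α β S V) μ
        = (if α = 2 then (⊤ : EReal) else ((α : ℝ) : EReal)) ∧
      LinnikDistribution.rhoMinus (LinnikDistribution.genLinnik α β S V) μ
        = ((-(min (α / β) 1) : ℝ) : EReal) ∧
      (∃ g : LinnikDistribution.GammaQuotient,
        LinnikDistribution.HasGammaMoments g (LinnikDistribution.genLinnik α β S V) μ
          (-(min (α / β) 1)) α ∧
        g.gam = 2 / α ∧ g.gam' = 1 ∧ g.del = 1 / β - 1 / 2 ∧ g.kap = 0)) ∧
    -- the factorization `X_α =d X_β Y_{α,β}`, with `Y_{α,β} = L_{α/β}^{1/β}`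
    (∀ (Ω : Type*) [MeasurableSpace Ω] (μ : Measure Ω) [IsProbabilityMeasure μ]
        (Ω' : Type*) [MeasurableSpace Ω'] (ν : Measure Ω') [IsProbabilityMeasure ν]
        (α β : ℝ) (S V : Ω → ℝ) (S' V' T T' : Ω' → ℝ),
      0 < α → α < β → β ≤ 2 →
      LinnikDistribution.IsSymmetricStable α S μ → HasLaw V (expMeasure 1) μ → IndepFun S V μ →
      LinnikDistribution.IsSymmetricStable β S' ν → HasLaw V' (expMeasure 1) ν →
      IndepFun S' V' ν →
      LinnikDistribution.IsPositiveStable (α / β) T ν →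
      LinnikDistribution.IsPositiveStable (α / β) T' ν → IndepFun T T' ν →
      IndepFun (LinnikDistribution.linnik β S' V')
        (fun ω => LinnikDistribution.lamperti T T' ω ^ (1 / β)) ν →
      IdentDistrib (LinnikDistribution.linnik α S V)
        (fun ω => LinnikDistribution.linnik β S' V' ω
          * LinnikDistribution.lamperti T T' ω ^ (1 / β)) μ ν) := by
  refine ⟨?_, ?_, ?_⟩
  · intro Ω _ μ _ α S V hα hα2 hS hV hSV
    have hV₁ : HasLaw V (genExpMeasure 1) μ := expMeasure_one_eq_genExpMeasure ▸ hV
    have hgamma := hasGammaMoments_genLinnik hα hα2 one_pos hS hV₁ hSV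
    have hrhoMinus := rhoMinus_genLinnik hα hα2 one_pos hS hV₁ hSV
    rw [div_one] at hgamma hrhoMinus
    exact ⟨charFun_linnik hα hS hV hSV, fun s => absMoment_linnik hα hα2 hS hV hSV,
      rhoPlus_genLinnik hα hα2 one_pos hS hV₁ hSV, hrhoMinus, genLinnikQuotient α 1 hα.ne', hgamma,
      gam_genLinnikQuotient hα, gam'_genLinnikQuotient hα.ne',
      (del_genLinnikQuotient hα.ne').trans (by norm_num), kap_genLinnikQuotient hα.ne',
      (C₁_genLinnikQuotient hα one_pos).trans (by simp)⟩
  · intro Ω _ μ _ α β S V hα hα2 hβ hS hV hSV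
    exact ⟨charFun_genLinnik hα hβ hS hV hSV, fun s => absMoment_genLinnik hα hα2 hβ hS hV hSV,
      rhoPlus_genLinnik hα hα2 hβ hS hV hSV, rhoMinus_genLinnik hα hα2 hβ hS hV hSV,
      genLinnikQuotient α β hα.ne', hasGammaMoments_genLinnik hα hα2 hβ hS hV hSV,
      gam_genLinnikQuotient hα, gam'_genLinnikQuotient hα.ne', del_genLinnikQuotient hα.ne',
      kap_genLinnikQuotient hα.ne'⟩
  · intro Ω _ μ _ Ω' _ ν _ α β S V S' V' T T' hα hαβ _ hS hV hSV hS' hV' hSV' hT hT' hTT' hind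
    exact identDistrib_linnik_mul_lamperti hα (hα.trans hαβ) hS hV hSV hS' hV' hSV' hT hT' hTT'
      hind
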